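/- All graphs are simple. Let $H$ be a connected (in particular non-empty) subgraph of a finite graph $G$. Call $H$ \emph{S-Eulerian} (\emph{semi S-Eulerian}) in $G$ if $G$ has a closed trail (an open trail, i.e. a trail with two distinct ends) that contains every edge of $H$; a closed trail of length $0$ is allowed. Let $F$ be the graph whose vertices are the vertices of $H$ of odd degree in $H$, two distinct ones being adjacent when they are joined by a path in $G-E(H)$. (1) Each of the two problems "given a finite graph $G$ and a connected subgraph $H$ of $G$, is $H$ S-Eulerian?" and "\dots, is $H$ semi S-Eulerian?" is solvable in linear time: there are a random access machine program and a constant $c$ such that the program, given the vertices of $G$ with the information which of them lie in $H$, and a list of the edges of $G$ (each exactly once, in any order) with the information which of them lie in $H$, halts after at most $c\,(|V(G)|+|E(G)|)$ steps with the correct answer. (2) $H$ is S-Eulerian if and only if every component of $F$ has even order, and if and only if $F$ has a perfect matching. (3) If $H$ has a vertex of odd degree, then $H$ is semi S-Eulerian if and only if $F$ has a matching that covers all but exactly two vertices of $F$. If all degrees of $H$ are even, then $H$ is semi S-Eulerian if and only if $G$ has an edge $e\notin E(H)$ such that $e$ has an end in $V(H)$ or $E(H)=\emptyset$. (4) There are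 algorithms (computable functions) which, given the same input, return a closed trail (an open trail) of $G$ that contains every edge of $H$ if there is one, and report that there is none otherwise. -/

import Mathlib

namespace SEulerian

/-! ### S-Eulerian subgraphs -/

section Graphs

variable {V : Type*} {G : SimpleGraph V}

/-- `p` is a closed trail of `G` through every edge of `H`
(a closed trail of length `0` is allowed; it can only occur if `H` has no edges). -/
def IsSEulerianCircuit (H : G.Subgraph) {u : V} (p : G.Walk u u) : Prop :=
  p.IsTrail ∧ ∀ e ∈ H.edgeSet, e ∈ p.edges

/-- `p` is an open trail of `G` (its ends are distinct) through every edge of `H`. -/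
def IsSEulerianTrail (H : G.Subgraph) {u v : V} (p : G.Walk u v) : Prop :=
  u ≠ v ∧ p.IsTrail ∧ ∀ e ∈ H.edgeSet, e ∈ p.edges

/-- `H` is S-Eulerian in `G`. -/
def IsSEulerian (H : G.Subgraph) : Prop :=
  ∃ (u : V) (p : G.Walk u u), IsSEulerianCircuit H p

/-- `H` is semi S-Eulerian in `G`. -/
def IsSemiSEulerian (H : G.Subgraph) : Prop :=
  ∃ (u v : V) (p : G.Walk u v), IsSEulerianTrail H p

/-- The vertices of `H` of odd degree in `H`. -/
def oddVerts (H : G.Subgraph) : Set V :=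
  {v | v ∈ H.verts ∧ Odd (H.neighborSet v).ncard}

/-- The graph `F` on the odd-degree vertices of `H`: two distinct vertices are adjacent when
a path of `G - E(H)` joins them. -/
def oddGraph (H : G.Subgraph) : SimpleGraph (oddVerts H) where
  Adj u v := u ≠ v ∧ ∃ p : (G.deleteEdges H.edgeSet).Walk (u : V) (v : V), p.IsPath
  symm := ⟨fun _ _ h => ⟨h.1.symm, h.2.elim fun p hp => ⟨p.reverse, hp.reverse⟩⟩⟩
  loopless := ⟨fun _ h => h.1 rfl⟩

end Graphs

/-! ### Random access machines

A memory consists of number registers `reg x` and of arrays `arr a`, all with natural number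
entries. A program is a fixed finite piece of code, so it mentions only finitely many registers
and arrays. The only arithmetic is `± 1`, so a value can exceed the input and the constants of
the program at most by the number of executed steps, and unit costs are realistic. -/

/-- Memory contents. -/
structure Memory where
  reg : ℕ → ℕ
  arr : ℕ → ℕ → ℕ

namespace Memory

/-- Write `k` into register `x`. -/
def setReg (σ : Memory) (x k : ℕ) : Memory where
  reg := Function.update σ.reg x k
  arr := σ.arr

/-- Write `k` into cell `i` of array `a`. -/
def setArr (σ : Memory) (a i k : ℕ) : Memory where
  reg := σ.reg
  arr := Function.update σ.arr a (Function.update (σ.arr a) i k)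

end Memory

/-- Programs of the machine. -/
inductive Prog where
  /-- do nothing -/
  | skip
  /-- `reg x := k` -/
  | const (x k : ℕ)
  /-- `reg x := reg y` -/
  | copy (x y : ℕ)
  /-- `reg x := reg y + 1` -/
  | succ (x y : ℕ)
  /-- `reg x := reg y - 1` (truncated at `0`) -/
  | pred (x y : ℕ)
  /-- `reg x := arr a [reg y]` -/
  | load (x a y : ℕ)
  /-- `arr a [reg y] := reg x` -/
  | store (a y x : ℕ)
  /-- run `P`, then `Q` -/
  | seq (P Q : Prog)
  /-- if `reg x < reg y` then `P` else `Q` -/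
  | ite (x y : ℕ) (P Q : Prog)
  /-- while `reg x < reg y` do `P` -/
  | loop (x y : ℕ) (P : Prog)

/-- `Exec P σ t τ`: started on memory `σ`, the program `P` halts after exactly `t` steps with
memory `τ`. Each basic instruction and each evaluation of a test counts as one step. -/
inductive Exec : Prog → Memory → ℕ → Memory → Prop
  | skip (σ : Memory) : Exec .skip σ 1 σ
  | const (x k : ℕ) (σ : Memory) : Exec (.const x k) σ 1 (σ.setReg x k)
  | copy (x y : ℕ) (σ : Memory) : Exec (.copy x y) σ 1 (σ.setReg x (σ.reg y))
  | succ (x y : ℕ) (σ : Memory) : Exec (.succ x y) σ 1 (σ.setReg x (σ.reg y + 1))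
  | pred (x y : ℕ) (σ : Memory) : Exec (.pred x y) σ 1 (σ.setReg x (σ.reg y - 1))
  | load (x a y : ℕ) (σ : Memory) : Exec (.load x a y) σ 1 (σ.setReg x (σ.arr a (σ.reg y)))
  | store (a y x : ℕ) (σ : Memory) : Exec (.store a y x) σ 1 (σ.setArr a (σ.reg y) (σ.reg x))
  | seq {P Q : Prog} {σ τ ρ : Memory} {s t : ℕ} (hP : Exec P σ s τ) (hQ : Exec Q τ t ρ) :
      Exec (.seq P Q) σ (s + t) ρ
  | ite_true {x y : ℕ} {P Q : Prog} {σ τ : Memory} {t : ℕ} (h : σ.reg x < σ.reg y)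
      (hP : Exec P σ t τ) : Exec (.ite x y P Q) σ (t + 1) τ
  | ite_false {x y : ℕ} {P Q : Prog} {σ τ : Memory} {t : ℕ} (h : ¬ σ.reg x < σ.reg y)
      (hQ : Exec Q σ t τ) : Exec (.ite x y P Q) σ (t + 1) τ
  | loop_false {x y : ℕ} {P : Prog} {σ : Memory} (h : ¬ σ.reg x < σ.reg y) :
      Exec (.loop x y P) σ 1 σ
  | loop_true {x y : ℕ} {P : Prog} {σ τ ρ : Memory} {s t : ℕ} (h : σ.reg x < σ.reg y)
      (hP : Exec P σ s τ) (hL : Exec (.loop x y P) τ t ρ) :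
      Exec (.loop x y P) σ (s + t + 1) ρ

/-- Number of steps and final memory are determined by program and initial memory. -/
theorem Exec.deterministic {P : Prog} {σ τ τ' : Memory} {t t' : ℕ}
    (h : Exec P σ t τ) (h' : Exec P σ t' τ') : t = t' ∧ τ = τ' := by
  induction h generalizing t' τ' with
  | skip | const | copy | succ | pred | load | store => cases h'; exact ⟨rfl, rfl⟩
  | seq _ _ ih1 ih2 =>
    cases h' with
    | seq h1 h2 =>
      obtain ⟨rfl, rfl⟩ := ih1 h1
      obtain ⟨rfl, rfl⟩ := ih2 h2
      exact ⟨rfl, rfl⟩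
  | ite_true h _ ih =>
    cases h' with
    | ite_true _ h1 => obtain ⟨rfl, rfl⟩ := ih h1; exact ⟨rfl, rfl⟩
    | ite_false hn _ => exact absurd h hn
  | ite_false h _ ih =>
    cases h' with
    | ite_true hn _ => exact absurd hn h
    | ite_false _ h1 => obtain ⟨rfl, rfl⟩ := ih h1; exact ⟨rfl, rfl⟩
  | loop_false h =>
    cases h' with
    | loop_false => exact ⟨rfl, rfl⟩
    | loop_true hn => exact absurd hn h
  | loop_true h _ _ ih1 ih2 =>
    cases h' with
    | loop_false hn => exact absurd h hn
    | loop_true _ h1 h2 =>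
      obtain ⟨rfl, rfl⟩ := ih1 h1
      obtain ⟨rfl, rfl⟩ := ih2 h2
      exact ⟨rfl, rfl⟩

/-! ### Problem instances -/

/-- Raw input data: for each vertex a bit (does it belong to `H`?), and a list of edges `u v`
of `G`, each with a bit (does it belong to `H`?). -/
abbrev Code : Type := List Bool × List (ℕ × ℕ × Bool)

/-- A listing of the pair `(G, H)`: every edge of `G` is listed exactly once, in any order and
in any orientation, and carries the information whether it is an edge of `H`. -/
structure Listing {n : ℕ} {G : SimpleGraph (Fin n)} (H : G.Subgraph) where
  edges : List (Fin n × Fin n × Bool)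
  nodup : (edges.map fun e => s(e.1, e.2.1)).Nodup
  mem_iff : ∀ e : Sym2 (Fin n), e ∈ edges.map (fun e => s(e.1, e.2.1)) ↔ e ∈ G.edgeSet
  bit_iff : ∀ e ∈ edges, e.2.2 = true ↔ s(e.1, e.2.1) ∈ H.edgeSet

open Classical in
/-- The raw data of a listing. -/
noncomputable def Listing.code {n : ℕ} {G : SimpleGraph (Fin n)} {H : G.Subgraph}
    (L : Listing H) : Code :=
  (List.ofFn fun i : Fin n => decide (i ∈ H.verts),
    L.edges.map fun e => ((e.1 : ℕ), (e.2.1 : ℕ), e.2.2))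

/-- Initial memory: the numbers of vertices and of edges stand in registers `0` and `1`,
array `0` holds the vertex bits, arrays `1` and `2` the ends of the edges, array `3` the edge
bits; everything else is `0`. -/
def initial (I : Code) : Memory where
  reg
    | 0 => I.1.length
    | 1 => I.2.length
    | _ => 0
  arr
    | 0 => fun i => (I.1.map Bool.toNat).getD i 0
    | 1 => fun i => (I.2.map fun e => e.1).getD i 0
    | 2 => fun i => (I.2.map fun e => e.2.1).getD i 0
    | 3 => fun i => (I.2.map fun e => e.2.2.toNat).getD i 0
    | _ => fun _ => 0

/-- The property `Q` of connected subgraphs of finite graphs is decidable in linear time: some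
program halts on each listing of `(G, H)`, `H` connected, within `c * (|V(G)| + |E(G)|)` steps,
with the correct answer (`1` for yes, `0` for no) in register `0`. -/
def DecidableInLinearTime
    (Q : ∀ {n : ℕ} {G : SimpleGraph (Fin n)}, G.Subgraph → Prop) : Prop :=
  ∃ (P : Prog) (c : ℕ), ∀ (n : ℕ) (G : SimpleGraph (Fin n)) (H : G.Subgraph), H.Connected →
    ∀ L : Listing H, ∃ (t : ℕ) (τ : Memory),
      Exec P (initial L.code) t τ ∧ t ≤ c * (n + G.edgeSet.ncard) ∧
      (Q H → τ.reg 0 = 1) ∧ (¬ Q H → τ.reg 0 = 0)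

end SEulerian

/-!
Throughout, `K = G - E(H)` and `T` is the set of the odd vertices of `H`; degrees of edge sets are
counted modulo two (`parity`).

*Characterizations.* If a trail from `u` to `v` contains all edges of `H`, its remaining edges form
an edge set of `K` with degree function `T + u + v`, so by the handshake lemma this function has sum
zero over each component of `K` (`balanced_of_trail`). Conversely, a function with sum zero over
each component of `K` is the degree function of an edge set of `K`, a sum of paths (`exists_join`).
Together with `H` it gives an edge set with the degrees of a trail, and a longest trail in it, being
saturated (`exists_saturated_trail`), contains the connected graph `H` (`trail_of_balanced`). Thus
`H` is S-Eulerian iff `T` meets each component of `K` evenly, and, if `T` is nonempty, semi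
S-Eulerian iff this holds after the removal of two vertices from `T`. A subset of `T` that meets
each component of `K` evenly is the same as the vertex set of a matching of `F`, since two odd
vertices are adjacent in `F` iff they lie in one component of `K`. If `T` is empty, the one thing
needed is an edge outside `H` by which `H` can be prolonged (`isSemiSEulerian_iff_exists_edge`).

*Linear time.* The program scans the edge list, computes the parities of the degrees in `H`, and
stores the darts of `K` in linked lists, one for each tail. A graph search in a single loop labels
the components of `K`. Its running time is bounded by a potential that decreases in each round
(`exec_loop`, `searchPotential`). Two more loops count the components with an odd number of odd
vertices. The graph `H` is S-Eulerian iff this number is `0`, and, if `T` is nonempty, semi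
S-Eulerian iff it is `0` or `2` (`card_oddLabels_iff`).

*Construction of the trails.* Computability has no time bound, so an exhaustive search through the
vertex sequences of bounded length suffices. It is primitive recursive.
-/

namespace SEulerian

/-! ### Degrees modulo two -/

section Parity

open scoped Classical

variable {V : Type*} {G K : SimpleGraph V}

/-- The degree of `x` in the edge set `X`, modulo two. -/
noncomputable def parity (X : Finset (Sym2 V)) (x : V) : ZMod 2 :=
  ∑ e ∈ X, if x ∈ e then 1 else 0

/-- The indicator function of the vertex `u`, with values in `ZMod 2`. -/
noncomputable def delta (u x : V) : ZMod 2 := if x = u then 1 else 0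

@[simp] lemma parity_empty (x : V) : parity ∅ x = 0 := by simp [parity]

lemma parity_insert {X : Finset (Sym2 V)} {e : Sym2 V} (he : e ∉ X) (x : V) :
    parity (insert e X) x = (if x ∈ e then 1 else 0) + parity X x := by
  rw [parity, Finset.sum_insert he, parity]

lemma parity_union {X Y : Finset (Sym2 V)} (h : Disjoint X Y) (x : V) :
    parity (X ∪ Y) x = parity X x + parity Y x := by
  rw [parity, Finset.sum_union h, parity, parity]

lemma parity_sdiff {X Y : Finset (Sym2 V)} (h : Y ⊆ X) (x : V) :
    parity (X \ Y) x = parity X x + parity Y x := by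
  have := Finset.sum_sdiff (f := fun e : Sym2 V => if x ∈ e then (1 : ZMod 2) else 0) h
  rw [parity, parity, ← this, ← parity, ← parity, add_assoc, CharTwo.add_self_eq_zero, add_zero]

lemma parity_symmDiff (X Y : Finset (Sym2 V)) (x : V) :
    parity (symmDiff X Y) x = parity X x + parity Y x := by
  have h : symmDiff X Y = (X ∪ Y) \ (X ∩ Y) := by
    simpa using symmDiff_eq_sup_sdiff_inf X Y
  rw [h, parity_sdiff (by grind)]
  exact Finset.sum_union_inter

lemma ite_mem_edge {u v : V} (h : u ≠ v) (x : V) :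
    (if x ∈ s(u, v) then (1 : ZMod 2) else 0) = delta u x + delta v x := by
  unfold delta
  by_cases h1 : x = u <;> by_cases h2 : x = v <;> simp_all

lemma parity_eq_sum (X : Finset (Sym2 V)) (x : V) : parity X x = ∑ e ∈ X, parity {e} x := by
  simp only [parity, Finset.sum_singleton]

lemma parity_edge {u v : V} (h : u ≠ v) (x : V) : parity {s(u, v)} x = delta u x + delta v x := by
  rw [parity, Finset.sum_singleton, ite_mem_edge h]

lemma parity_trail {u v : V} (p : G.Walk u v) (hp : p.IsTrail) (x : V) :
    parity p.edges.toFinset x = delta u x + delta v x := by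
  induction p with
  | nil => simp [CharTwo.add_self_eq_zero]
  | @cons a b c h p ih =>
    rw [SimpleGraph.Walk.isTrail_cons] at hp
    rw [SimpleGraph.Walk.edges_cons, List.toFinset_cons, parity_insert (by simpa using hp.2),
      ih hp.1, ite_mem_edge h.ne]
    linear_combination CharTwo.add_self_eq_zero (delta b x)

/-- Handshake lemma: a vertex set without edges leaving it has even degree sum. -/
lemma sum_parity_eq_zero {X : Finset (Sym2 V)} (S : Finset V)
    (hX : ∀ a b, s(a, b) ∈ X → a ≠ b ∧ (a ∈ S ↔ b ∈ S)) : ∑ x ∈ S, parity X x = 0 := by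
  unfold parity
  rw [Finset.sum_comm]
  refine Finset.sum_eq_zero fun e he => ?_
  induction e with | _ a b => ?_
  obtain ⟨hab, hS⟩ := hX a b he
  simp only [ite_mem_edge hab, Finset.sum_add_distrib, delta, Finset.sum_ite_eq', hS]
  exact CharTwo.add_self_eq_zero _

lemma zmod_two_eq_one {a : ZMod 2} (h : a ≠ 0) : a = 1 := by
  revert a; decide

variable [Fintype V]

/-- The vertex set of the component of `v` in `K`. -/
noncomputable def comp (K : SimpleGraph V) (v : V) : Finset V :=
  Finset.univ.filter (K.Reachable v)

@[simp] lemma mem_comp {v x : V} : x ∈ comp K v ↔ K.Reachable v x := by simp [comp]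

/-- A function that sums to zero over the component of `v`, and does not vanish at `v`, is nonzero
at a second vertex of this component. -/
lemma exists_second {f : V → ZMod 2} {v : V}
    (hf : ∑ x ∈ comp K v, f x = 0) (hv : f v ≠ 0) :
    ∃ w, w ≠ v ∧ K.Reachable v w ∧ f w ≠ 0 := by
  by_contra! h
  refine hv ?_
  rw [← hf, Finset.sum_eq_single v]
  · intro b hb hbv
    exact h b hbv (by simpa using hb)
  · simp

lemma sum_comp_delta (a v : V) :
    ∑ x ∈ comp K v, delta a x = if K.Reachable v a then 1 else 0 := by
  simp only [delta, Finset.sum_ite_eq', mem_comp]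

lemma sum_delta_add {a b : V} (hab : K.Reachable a b) (v : V) :
    ∑ x ∈ comp K v, (delta a x + delta b x) = 0 := by
  simp only [Finset.sum_add_distrib, sum_comp_delta]
  simp only [show K.Reachable v b ↔ K.Reachable v a from
    ⟨fun h => h.trans hab.symm, fun h => h.trans hab⟩]
  exact CharTwo.add_self_eq_zero _

/-- Existence of joins: a function with sum zero on each component is the degree function, modulo
two, of an edge set. It arises by adding up paths between pairs of vertices. -/
lemma exists_join (f : V → ZMod 2) (hf : ∀ v, ∑ x ∈ comp K v, f x = 0) :
    ∃ X : Finset (Sym2 V), (∀ e ∈ X, e ∈ K.edgeSet) ∧ ∀ x, parity X x = f x := by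
  induction hn : Finset.card {x | f x ≠ 0} using Nat.strong_induction_on generalizing f with
  | _ n ih =>
    by_cases h0 : ∀ x, f x = 0
    · exact ⟨∅, by simp, by simp [h0]⟩
    push Not at h0
    obtain ⟨a, ha⟩ := h0
    obtain ⟨b, hba, hab, hb⟩ := exists_second (hf a) ha
    have hlt : Finset.card {x | f x + (delta a x + delta b x) ≠ 0} < n := by
      rw [← hn]
      refine Finset.card_lt_card ((Finset.ssubset_iff_of_subset fun x hx => ?_).2 ⟨a, ?_, ?_⟩)
      · rw [Finset.mem_filter] at hx ⊢
        refine ⟨Finset.mem_univ x, fun hx0 => hx.2 ?_⟩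
        have hxa : x ≠ a := fun h => ha (h ▸ hx0)
        have hxb : x ≠ b := fun h => hb (h ▸ hx0)
        simp [delta, hx0, hxa, hxb]
      · simpa using ha
      · rw [Finset.mem_filter]
        intro h
        exact h.2 (by simp only [delta, zmod_two_eq_one ha, if_neg hba.symm, if_true]; rfl)
    obtain ⟨X, hX, hXf⟩ := ih _ hlt (fun x => f x + (delta a x + delta b x))
      (fun v => by rw [Finset.sum_add_distrib, hf, sum_delta_add hab, add_zero]) rfl
    obtain ⟨p, hp⟩ := hab.exists_isPath
    refine ⟨symmDiff X p.edges.toFinset, fun e he => ?_, fun x => ?_⟩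
    · rw [Finset.mem_symmDiff] at he
      rcases he with he | he
      · exact hX e he.1
      · exact p.edges_subset_edgeSet (by simpa using he.1)
    · rw [parity_symmDiff, parity_trail p hp.isTrail, hXf]
      linear_combination CharTwo.add_self_eq_zero (delta a x + delta b x)

end Parity

/-! ### Eulerian trails -/

section Euler

open scoped Classical

variable {V : Type*} {G : SimpleGraph V}

/-- If all degrees in the edge set `X` are even, each edge of `X` at `a` is witness to a nontrivial
closed trail at `a`: a longest trail in `X` that ends at `a` also starts there, since otherwise its
start would have an unused edge. -/
lemma exists_closed_trail {X : Finset (Sym2 V)} (hX : ∀ e ∈ X, e ∈ G.edgeSet)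
    (hev : ∀ x, parity X x = 0) {a b : V} (hab : s(a, b) ∈ X) :
    ∃ p : G.Walk a a, p.IsTrail ∧ (∀ e ∈ p.edges, e ∈ X) ∧ 0 < p.length := by
  let good : ℕ → Prop := fun n => ∃ (c : V) (p : G.Walk c a), p.IsTrail ∧
    (∀ e ∈ p.edges, e ∈ X) ∧ p.length = n
  have hbd : ∀ n, good n → n ≤ X.card := by
    rintro n ⟨c, p, hp, hpX, rfl⟩
    rw [← p.length_edges, ← List.toFinset_card_of_nodup hp.edges_nodup]
    exact Finset.card_le_card fun e he => hpX e (by simpa using he)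
  have h1 : good 1 :=
    ⟨b, .cons (show G.Adj b a from (hX _ hab).symm) .nil, by simp, by
      simpa [Sym2.eq_swap] using hab, rfl⟩
  have hle : 1 ≤ X.card := hbd 1 h1
  obtain ⟨c, p, hp, hpX, hlen⟩ := Nat.findGreatest_spec hle h1
  have hmax : 1 ≤ p.length := hlen ▸ Nat.le_findGreatest hle h1
  suffices hca : c = a by
    subst hca
    exact ⟨p, hp, hpX, hmax⟩
  by_contra hca
  have hsub : p.edges.toFinset ⊆ X := fun e he => hpX e (by simpa using he)
  have hpar : parity (X \ p.edges.toFinset) c = 1 := by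
    rw [parity_sdiff hsub, hev, parity_trail p hp]
    simp [delta, hca]
  have hex : ∃ e ∈ X \ p.edges.toFinset, c ∈ e := by
    by_contra! h
    rw [parity, Finset.sum_eq_zero fun e he => if_neg (h e he)] at hpar
    exact absurd hpar (by decide)
  obtain ⟨e, he, d, rfl⟩ := hex
  rw [Finset.mem_sdiff, List.mem_toFinset] at he
  have hadj : G.Adj d c := (hX _ he.1).symm
  have hnew : good (p.length + 1) := by
    refine ⟨d, .cons hadj p, ?_, ?_, rfl⟩
    · rw [SimpleGraph.Walk.isTrail_cons]
      exact ⟨hp, by rw [Sym2.eq_swap]; exact he.2⟩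
    · intro e' he'
      rw [SimpleGraph.Walk.edges_cons, List.mem_cons] at he'
      rcases he' with rfl | he'
      · rw [Sym2.eq_swap]; exact he.1
      · exact hpX e' he'
  have := Nat.le_findGreatest (hbd _ hnew) hnew
  omega

/-- If the degrees of `X` have the parities of a trail from `u` to `v`, then a longest trail from
`u` to `v` in `X` uses all edges of `X` at its vertices: closed trails could be spliced in. -/
lemma exists_saturated_trail {X : Finset (Sym2 V)} (hX : ∀ e ∈ X, e ∈ G.edgeSet) {u v : V}
    (hpar : ∀ x, parity X x = delta u x + delta v x) (p₀ : G.Walk u v) (hp₀ : p₀.IsTrail)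
    (hp₀X : ∀ e ∈ p₀.edges, e ∈ X) :
    ∃ p : G.Walk u v, p.IsTrail ∧ ∀ e ∈ X, ∀ x ∈ e, x ∈ p.support → e ∈ p.edges := by
  let good : ℕ → Prop := fun n => ∃ p : G.Walk u v, p.IsTrail ∧ (∀ e ∈ p.edges, e ∈ X) ∧
    p.length = n
  have hbd : ∀ n, good n → n ≤ X.card := by
    rintro n ⟨p, hp, hpX, rfl⟩
    rw [← p.length_edges, ← List.toFinset_card_of_nodup hp.edges_nodup]
    exact Finset.card_le_card fun e he => hpX e (by simpa using he)
  have h0 : good p₀.length := ⟨p₀, hp₀, hp₀X, rfl⟩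
  obtain ⟨p, hp, hpX, hlen⟩ := Nat.findGreatest_spec (hbd _ h0) h0
  refine ⟨p, hp, fun e heX x hxe hxp => ?_⟩
  by_contra hep
  have hsub : p.edges.toFinset ⊆ X := fun e he => hpX e (by simpa using he)
  obtain ⟨y, rfl⟩ := hxe
  obtain ⟨q, hq, hqX, hq0⟩ := exists_closed_trail (X := X \ p.edges.toFinset) (G := G)
    (fun e he => hX e (Finset.mem_sdiff.1 he).1)
    (fun x => by
      rw [parity_sdiff hsub, hpar, parity_trail p hp]; exact CharTwo.add_self_eq_zero _)
    (a := x) (b := y) (by simpa using ⟨heX, hep⟩)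
  have hnew : good (p.length + q.length) := by
    have hedges := congrArg SimpleGraph.Walk.edges (p.take_spec hxp)
    have hlen := congrArg SimpleGraph.Walk.length (p.take_spec hxp)
    rw [SimpleGraph.Walk.edges_append] at hedges
    rw [SimpleGraph.Walk.length_append] at hlen
    -- up to order, the new edge list is that of `q` followed by that of `p`
    have hperm : ((p.takeUntil x hxp).append (q.append (p.dropUntil x hxp))).edges.Perm
        (q.edges ++ p.edges) := by
      rw [← hedges, SimpleGraph.Walk.edges_append, SimpleGraph.Walk.edges_append,
        ← List.append_assoc, ← List.append_assoc]
      exact List.perm_append_comm.append_right _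
    refine ⟨(p.takeUntil x hxp).append (q.append (p.dropUntil x hxp)), ⟨?_⟩, ?_, ?_⟩
    · rw [hperm.nodup_iff, List.nodup_append]
      refine ⟨hq.edges_nodup, hp.edges_nodup, fun a ha b hb => ?_⟩
      rintro rfl
      have := hqX a ha
      simp [hb] at this
    · intro e he
      rw [hperm.mem_iff, List.mem_append] at he
      rcases he with he | he
      · exact (Finset.mem_sdiff.1 (hqX e he)).1
      · exact hpX e he
    · rw [SimpleGraph.Walk.length_append, SimpleGraph.Walk.length_append]
      omega
  have := Nat.le_findGreatest (hbd _ hnew) hnew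
  omega

/-- A trail that saturates an edge set containing the connected graph `H` and that meets `H`
contains all edges of `H`. -/
lemma edges_subset_of_saturated {H : G.Subgraph} (hH : H.Connected) {u v : V} {p : G.Walk u v}
    (hp : ∀ e ∈ H.edgeSet, ∀ x ∈ e, x ∈ p.support → e ∈ p.edges)
    {w : V} (hw : w ∈ H.verts) (hwp : w ∈ p.support) : ∀ e ∈ H.edgeSet, e ∈ p.edges := by
  have hall : ∀ z : H.verts, (z : V) ∈ p.support := by
    intro z
    obtain ⟨q⟩ := hH.preconnected.coe ⟨w, hw⟩ z
    have key : ∀ {a b : H.verts} (q : H.coe.Walk a b), (a : V) ∈ p.support →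
        (b : V) ∈ p.support := by
      intro a b q
      induction q with
      | nil => exact id
      | @cons a b c h q ih =>
        intro ha
        have := hp s((a : V), (b : V)) h a (by simp) ha
        exact ih (p.snd_mem_support_of_mem_edges this)
    exact key q hwp
  intro e he
  induction e with | _ a b =>
  exact hp _ he a (by simp) (hall ⟨a, H.edge_vert he⟩)

end Euler

/-! ### Characterizations by parities on the components of the complement -/

section Characterization

open scoped Classical

variable {V : Type*} {G K : SimpleGraph V}

/-- The indicator function of the vertex set `S`, with values in `ZMod 2`. -/
noncomputable def ind (S : Set V) (x : V) : ZMod 2 := if x ∈ S then 1 else 0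

/-- The graph `G - E(H)`. -/
abbrev rest (H : G.Subgraph) : SimpleGraph V := G.deleteEdges H.edgeSet

/-- The function `f` has sum zero over the vertex set of each component of `K`. -/
def Balanced [Fintype V] (K : SimpleGraph V) (f : V → ZMod 2) : Prop :=
  ∀ v, ∑ x ∈ comp K v, f x = 0

lemma ind_diff_pair {S : Set V} {a b : V} (ha : a ∈ S) (hb : b ∈ S) (hab : a ≠ b) :
    ind (S \ {a, b}) = fun x => ind S x + (delta a x + delta b x) := by
  funext x
  unfold ind delta
  by_cases h1 : x = a
  · subst h1; simp [ha, hab]; rfl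
  by_cases h2 : x = b
  · subst h2; simp [hb, h1]; rfl
  simp [h1, h2]

lemma ind_ne_zero {S : Set V} {x : V} : ind S x ≠ 0 ↔ x ∈ S := by simp [ind]

lemma mem_oddVerts {H : G.Subgraph} {x : V} : x ∈ oddVerts H ↔ Odd (H.neighborSet x).ncard := by
  refine ⟨fun h => h.2, fun h => ⟨?_, h⟩⟩
  by_contra hx
  have : H.neighborSet x = ∅ := by
    ext y
    simpa using fun hy : H.Adj x y => hx (H.edge_vert hy)
  simp [this] at h

lemma exists_trail_in_subgraph {H : G.Subgraph} (hH : H.Connected) {u v : V} (hu : u ∈ H.verts)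
    (hv : v ∈ H.verts) : ∃ p : G.Walk u v, p.IsTrail ∧ ∀ e ∈ p.edges, e ∈ H.edgeSet := by
  let φ : H.coe →g H.spanningCoe := ⟨Subtype.val, fun h => h⟩
  obtain ⟨q, hq⟩ := ((hH.preconnected.coe ⟨u, hu⟩ ⟨v, hv⟩).map φ).exists_isPath
  refine ⟨q.mapLe H.spanningCoe_le, hq.isTrail.mapLe _, fun e he => ?_⟩
  rw [SimpleGraph.Walk.edges_mapLe_eq_edges] at he
  simpa using q.edges_subset_edgeSet he

/-- If a walk starts in `H` and all its edges with an end in `H` are edges of `H`, then all its edges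
are. -/
lemma edges_mem_of_start_mem {H : G.Subgraph} {u v : V} (p : G.Walk u v) (hu : u ∈ H.verts)
    (h : ∀ e ∈ p.edges, (∃ x ∈ H.verts, x ∈ e) → e ∈ H.edgeSet) :
    ∀ e ∈ p.edges, e ∈ H.edgeSet := by
  induction p with
  | nil => simp
  | @cons a b c hab p ih =>
    have h1 : s(a, b) ∈ H.edgeSet := h _ (by simp) ⟨a, hu, by simp⟩
    intro e he
    rw [SimpleGraph.Walk.edges_cons, List.mem_cons] at he
    rcases he with rfl | he
    · exact h1
    · exact ih (H.edge_vert (H.symm.symm _ _ h1)) (fun e he => h e (by simp [he])) e he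

variable [Fintype V]

lemma Balanced.add {f g : V → ZMod 2} (hf : Balanced K f) (hg : Balanced K g) :
    Balanced K (fun x => f x + g x) := fun v => by
  rw [Finset.sum_add_distrib, hf, hg, add_zero]

lemma balanced_delta {a b : V} (hab : K.Reachable a b) :
    Balanced K (fun x => delta a x + delta b x) := sum_delta_add hab

lemma balanced_ind_iff (S : Set V) :
    Balanced K (ind S) ↔ ∀ v, Even {x | x ∈ S ∧ K.Reachable v x}.ncard := by
  refine forall_congr' fun v => ?_
  have h : {x | x ∈ S ∧ K.Reachable v x}.ncard = ((comp K v).filter (· ∈ S)).card := by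
    rw [← Set.ncard_coe_finset]
    congr 1
    ext x
    simp [and_comm]
  rw [h, ← ZMod.natCast_eq_zero_iff_even]
  simp only [ind, Finset.sum_boole]

lemma parity_edgeSet (H : G.Subgraph) (x : V) :
    parity H.edgeSet.toFinset x = ind (oddVerts H) x := by
  have h1 : (H.neighborSet x).ncard = (H.edgeSet.toFinset.filter (x ∈ ·)).card := by
    rw [← Set.ncard_coe_finset, ← Set.InjOn.ncard_image (f := fun y => s(x, y))
      (fun a _ b _ h => Sym2.congr_right.1 h)]
    congr 1
    ext e
    simp only [Set.mem_image, Finset.coe_filter, Set.mem_toFinset, Set.mem_ofPred_eq]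
    constructor
    · rintro ⟨y, hy, rfl⟩
      exact ⟨hy, by simp⟩
    · rintro ⟨he, y, rfl⟩
      exact ⟨y, he, rfl⟩
  rw [parity, Finset.sum_boole, ← h1, ind]
  split_ifs with h
  · exact (ZMod.natCast_eq_one_iff_odd).2 (mem_oddVerts.1 h)
  · exact (ZMod.natCast_eq_zero_iff_even).2 (Nat.not_odd_iff_even.1 fun h' => h (mem_oddVerts.2 h'))

/-- The edges of a trail through `H` outside `H` balance the odd vertices of `H` and the ends of the
trail. -/
lemma balanced_of_trail {H : G.Subgraph} {u v : V} {p : G.Walk u v} (hp : p.IsTrail)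
    (hHp : ∀ e ∈ H.edgeSet, e ∈ p.edges) :
    Balanced (rest H) (fun x => ind (oddVerts H) x + (delta u x + delta v x)) := by
  intro w
  have hsub : H.edgeSet.toFinset ⊆ p.edges.toFinset := fun e he => by
    simpa using hHp e (by simpa using he)
  refine (Finset.sum_congr rfl fun x _ => ?_).trans
    (sum_parity_eq_zero (X := p.edges.toFinset \ H.edgeSet.toFinset) _ ?_)
  · rw [parity_sdiff hsub, parity_trail p hp, parity_edgeSet, add_comm]
  · intro a b hab
    simp only [Finset.mem_sdiff, List.mem_toFinset, Set.mem_toFinset] at hab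
    have hG : G.Adj a b := p.edges_subset_edgeSet hab.1
    have hK : (rest H).Adj a b := by
      rw [SimpleGraph.deleteEdges_adj]; exact ⟨hG, hab.2⟩
    refine ⟨hG.ne, ?_⟩
    simp only [mem_comp]
    exact ⟨fun h => h.trans hK.reachable, fun h => h.trans hK.reachable.symm⟩

/-- Conversely, a join completes `H` to an edge set with an Eulerian trail. -/
lemma trail_of_balanced {H : G.Subgraph} (hH : H.Connected) {u v : V} (hu : u ∈ H.verts)
    (hv : v ∈ H.verts)
    (hbal : Balanced (rest H) (fun x => ind (oddVerts H) x + (delta u x + delta v x))) :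
    ∃ p : G.Walk u v, p.IsTrail ∧ ∀ e ∈ H.edgeSet, e ∈ p.edges := by
  obtain ⟨J, hJ, hJp⟩ := exists_join _ hbal
  have hJ' : ∀ e ∈ J, e ∈ G.edgeSet ∧ e ∉ H.edgeSet := fun e he => by
    have := hJ e he
    rwa [SimpleGraph.edgeSet_deleteEdges] at this
  have hdis : Disjoint H.edgeSet.toFinset J := by
    rw [Finset.disjoint_left]
    intro e he heJ
    exact (hJ' e heJ).2 (by simpa using he)
  obtain ⟨q, hq, hqH⟩ := exists_trail_in_subgraph hH hu hv
  obtain ⟨p, hp, hpX⟩ := exists_saturated_trail (X := H.edgeSet.toFinset ∪ J) (G := G)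
    (u := u) (v := v)
    (fun e he => by
      rcases Finset.mem_union.1 he with he | he
      · exact H.edgeSet_subset (by simpa using he)
      · exact (hJ' e he).1)
    (fun x => by
      rw [parity_union hdis, hJp, parity_edgeSet]
      linear_combination CharTwo.add_self_eq_zero (ind (oddVerts H) x))
    q hq (fun e he => Finset.mem_union_left _ (by simpa using hqH e he))
  refine ⟨p, hp, edges_subset_of_saturated hH (fun e he => hpX e ?_) hu p.start_mem_support⟩
  exact Finset.mem_union_left _ (by simpa using he)

theorem isSEulerian_iff_balanced {H : G.Subgraph} (hH : H.Connected) :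
    IsSEulerian H ↔ Balanced (rest H) (ind (oddVerts H)) := by
  have hself : ∀ u : V, (fun x => ind (oddVerts H) x + (delta u x + delta u x)) =
      ind (oddVerts H) := fun u => by
    funext x; rw [CharTwo.add_self_eq_zero, add_zero]
  constructor
  · rintro ⟨u, p, hp, hpH⟩
    have := balanced_of_trail hp hpH
    rwa [hself] at this
  · intro h
    obtain ⟨u, hu⟩ := hH.nonempty
    obtain ⟨p, hp⟩ := trail_of_balanced hH hu hu (by rwa [hself])
    exact ⟨u, p, hp⟩

/-- The ends of an open trail through `H` need not be odd vertices of `H`, but then they can be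
replaced: by odd vertices in their components of `G - E(H)` if these are different, and by any two
odd vertices in a common component otherwise. -/
theorem isSemiSEulerian_iff_balanced {H : G.Subgraph} (hH : H.Connected)
    (hT : (oddVerts H).Nonempty) :
    IsSemiSEulerian H ↔ ∃ a b, a ≠ b ∧ a ∈ oddVerts H ∧ b ∈ oddVerts H ∧
      Balanced (rest H) (ind (oddVerts H \ {a, b})) := by
  constructor
  · rintro ⟨u, v, p, huv, hp, hpH⟩
    have hb := balanced_of_trail hp hpH
    by_cases hr : (rest H).Reachable u v
    · have hb' : Balanced (rest H) (ind (oddVerts H)) := by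
        have := hb.add (balanced_delta hr)
        refine (congrArg (Balanced (rest H)) ?_).mp this
        funext x
        linear_combination CharTwo.add_self_eq_zero (delta u x + delta v x)
      obtain ⟨a, ha⟩ := hT
      obtain ⟨b, hba, hab, hb⟩ := exists_second (hb' a) (ind_ne_zero.2 ha)
      refine ⟨a, b, hba.symm, ha, ind_ne_zero.1 hb, ?_⟩
      rw [ind_diff_pair ha (ind_ne_zero.1 hb) hba.symm]
      exact hb'.add (balanced_delta hab)
    · -- the components of both ends contain an odd vertex
      have key : ∀ {u v : V}, ¬ (rest H).Reachable u v → Balanced (rest H)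
          (fun x => ind (oddVerts H) x + (delta u x + delta v x)) →
          ∃ a, a ∈ oddVerts H ∧ (rest H).Reachable u a := by
        intro u v hr hb
        by_contra! h
        have h1 : ∀ x, (rest H).Reachable u x →
            ind (oddVerts H) x + (delta u x + delta v x) = delta u x := by
          intro x hx'
          have h1 : x ∉ oddVerts H := fun h' => h x h' hx'
          have h2 : x ≠ v := by rintro rfl; exact hr hx'
          simp [ind, h1, h2, delta]
        have h0 : ∑ x ∈ comp (rest H) u, delta u x = 0 := (Finset.sum_congr rfl fun x hx =>
          (h1 x (mem_comp.1 hx)).symm).trans (hb u)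
        simp [delta] at h0
      obtain ⟨a, ha, hua⟩ := key hr hb
      obtain ⟨b, hb', hvb⟩ := key (u := v) (v := u) (fun h => hr h.symm)
        (by simpa only [add_comm (delta u _)] using hb)
      have hab : a ≠ b := by
        rintro rfl
        exact hr (hua.trans hvb.symm)
      refine ⟨a, b, hab, ha, hb', ?_⟩
      rw [ind_diff_pair ha hb' hab]
      refine (congrArg (Balanced (rest H)) ?_).mp
        ((hb.add (balanced_delta hua)).add (balanced_delta hvb))
      funext x
      linear_combination CharTwo.add_self_eq_zero (delta u x) + CharTwo.add_self_eq_zero (delta v x)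
  · rintro ⟨a, b, hab, ha, hb, h⟩
    rw [ind_diff_pair ha hb hab] at h
    obtain ⟨p, hp⟩ := trail_of_balanced hH ha.1 hb.1 h
    exact ⟨a, b, p, hab, hp⟩

theorem isSemiSEulerian_iff_exists_edge {H : G.Subgraph} (hH : H.Connected)
    (hT : oddVerts H = ∅) :
    IsSemiSEulerian H ↔
      ∃ e ∈ G.edgeSet, e ∉ H.edgeSet ∧ (H.edgeSet = ∅ ∨ ∃ v ∈ H.verts, v ∈ e) := by
  have hpar : ∀ x, parity H.edgeSet.toFinset x = 0 := fun x => by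
    rw [parity_edgeSet, hT]; simp [ind]
  constructor
  · rintro ⟨u, v, p, huv, hp, hpH⟩
    by_contra! hcon
    -- otherwise, cut at a vertex of `H`, both parts of the trail stay in `H`
    have hall : ∀ e ∈ p.edges, e ∈ H.edgeSet := by
      by_cases hE : H.edgeSet = ∅
      · intro e he
        by_contra heH
        exact (hcon e (p.edges_subset_edgeSet he) heH).1.ne_empty hE
      obtain ⟨e₀, he₀⟩ := Set.nonempty_iff_ne_empty.2 hE
      induction e₀ with | _ a b =>
      have haV : a ∈ H.verts := H.edge_vert he₀
      have hap : a ∈ p.support := p.fst_mem_support_of_mem_edges (hpH _ he₀)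
      have hstay : ∀ e ∈ p.edges, (∃ x ∈ H.verts, x ∈ e) → e ∈ H.edgeSet := by
        rintro e he ⟨x, hx, hxe⟩
        by_contra heH
        exact (hcon e (p.edges_subset_edgeSet he) heH).2 x hx hxe
      have hsplit := congrArg SimpleGraph.Walk.edges (p.take_spec hap)
      rw [SimpleGraph.Walk.edges_append] at hsplit
      intro e he
      rw [← hsplit, List.mem_append] at he
      rcases he with he | he
      · refine edges_mem_of_start_mem (p.takeUntil a hap).reverse haV (fun e' he' => ?_) e
          (by simpa using he)
        exact hstay e' (p.edges_takeUntil_subset_edges hap (by simpa using he'))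
      · exact edges_mem_of_start_mem (p.dropUntil a hap) haV
          (fun e' he' => hstay e' (p.edges_dropUntil_subset_edges hap he')) e he
    have heq : p.edges.toFinset = H.edgeSet.toFinset := by
      ext e
      simpa using ⟨hall e, hpH e⟩
    -- so the trail consists of the edges of `H`, but its end `u` is odd
    have h1 := parity_trail p hp u
    rw [heq, hpar] at h1
    simp [delta, huv] at h1
  · rintro ⟨e, he, heH, h⟩
    by_cases hE : H.edgeSet = ∅
    · induction e with | _ a b =>
      exact ⟨a, b, .cons he .nil, G.ne_of_adj he,
        (SimpleGraph.Walk.isTrail_cons _ _).2 ⟨.nil, by simp⟩, by simp [hE]⟩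
    obtain ⟨w, hw, b, rfl⟩ := h.resolve_left hE
    have hwb : G.Adj w b := he
    have hni : s(w, b) ∉ H.edgeSet.toFinset := by simpa using heH
    obtain ⟨p, hp, hpX⟩ := exists_saturated_trail (X := insert s(w, b) H.edgeSet.toFinset)
      (G := G) (u := w) (v := b)
      (fun e he => by
        rcases Finset.mem_insert.1 he with rfl | he
        · assumption
        · exact H.edgeSet_subset (by simpa using he))
      (fun x => by rw [parity_insert hni, hpar, ite_mem_edge hwb.ne, add_zero])
      (.cons hwb .nil) (by simp) (by simp)
    exact ⟨w, b, p, hwb.ne, hp, edges_subset_of_saturated hH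
      (fun e he => hpX e (Finset.mem_insert_of_mem (by simpa using he))) hw p.start_mem_support⟩

end Characterization

/-! ### Matchings of the graph on the odd vertices -/

section Matching

open scoped Classical

variable {V : Type*} {G K : SimpleGraph V}

lemma oddGraph_adj {H : G.Subgraph} {a b : oddVerts H} :
    (oddGraph H).Adj a b ↔ a ≠ b ∧ (rest H).Reachable a b :=
  ⟨fun h => ⟨h.1, h.2.elim fun p _ => ⟨p⟩⟩, fun h => ⟨h.1, h.2.exists_isPath⟩⟩

lemma oddGraph_reachable {H : G.Subgraph} {a b : oddVerts H} :
    (oddGraph H).Reachable a b ↔ (rest H).Reachable a b := by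
  constructor
  · rintro ⟨p⟩
    induction p with
    | nil => rfl
    | cons h p ih => exact (oddGraph_adj.1 h).2.trans ih
  · intro h
    by_cases hab : a = b
    · rw [hab]
    · exact (oddGraph_adj.2 ⟨hab, h⟩).reachable

variable [Fintype V]

lemma balanced_iff_components (H : G.Subgraph) :
    Balanced (rest H) (ind (oddVerts H)) ↔
      ∀ C : (oddGraph H).ConnectedComponent, Even C.supp.ncard := by
  have key : ∀ a : oddVerts H, ((oddGraph H).connectedComponentMk a).supp.ncard =
      {x | x ∈ oddVerts H ∧ (rest H).Reachable a x}.ncard := by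
    intro a
    rw [← Set.ncard_image_of_injective _ Subtype.val_injective]
    congr 1
    ext x
    simp only [Set.mem_image, SimpleGraph.ConnectedComponent.mem_supp_iff,
      SimpleGraph.ConnectedComponent.eq, Set.mem_ofPred_eq, oddGraph_reachable]
    constructor
    · rintro ⟨y, hy, rfl⟩
      exact ⟨y.2, hy.symm⟩
    · rintro ⟨hx, h⟩
      exact ⟨⟨x, hx⟩, h.symm, rfl⟩
  rw [balanced_ind_iff]
  constructor
  · intro h C
    induction C using SimpleGraph.ConnectedComponent.ind with | _ a =>
    rw [key]
    exact h a
  · intro h v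
    by_cases hv : ∃ a ∈ oddVerts H, (rest H).Reachable v a
    · obtain ⟨a, ha, hva⟩ := hv
      have := h ((oddGraph H).connectedComponentMk ⟨a, ha⟩)
      rw [key] at this
      have heq : ∀ x, (rest H).Reachable v x ↔ (rest H).Reachable a x :=
        fun x => ⟨fun h => hva.symm.trans h, fun h => hva.trans h⟩
      simpa only [heq] using this
    · push Not at hv
      rw [show {x | x ∈ oddVerts H ∧ (rest H).Reachable v x} = ∅ from
        Set.eq_empty_of_forall_notMem fun x hx => hv x hx.1 hx.2, Set.ncard_empty]
      exact Even.zero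

/-- The covered vertices cancel in pairs, as partners lie in the same component of `G - E(H)`. -/
lemma balanced_of_matching {H : G.Subgraph} {M : (oddGraph H).Subgraph} (hM : M.IsMatching) :
    Balanced (rest H) (ind (Subtype.val '' M.verts)) := by
  intro v
  have hex : ∀ x : V, ∃ y : V, ((∃ hx hy, M.Adj ⟨x, hx⟩ ⟨y, hy⟩)) ∨
      (x ∉ Subtype.val '' M.verts ∧ y = x) := by
    intro x
    by_cases hx : x ∈ Subtype.val '' M.verts
    · obtain ⟨a, ha, rfl⟩ := hx
      obtain ⟨b, hb, -⟩ := hM ha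
      exact ⟨b, Or.inl ⟨a.2, b.2, hb⟩⟩
    · exact ⟨x, Or.inr ⟨hx, rfl⟩⟩
  choose g hg using hex
  have hgg : ∀ x, g (g x) = x := by
    intro x
    rcases hg x with ⟨hx, hy, h⟩ | ⟨hx, h⟩
    · rcases hg (g x) with ⟨hx', hy', h'⟩ | ⟨hx', h'⟩
      · have := (hM (M.edge_vert h')).unique h' (M.symm.symm _ _ h)
        exact congrArg Subtype.val this
      · exact absurd ⟨_, M.edge_vert (M.symm.symm _ _ h), rfl⟩ hx'
    · rw [h, h]
  have hind : ∀ x, ind (Subtype.val '' M.verts) (g x) = ind (Subtype.val '' M.verts) x := by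
    intro x
    rcases hg x with ⟨hx, hy, h⟩ | ⟨hx, h⟩
    · rw [ind, ind, if_pos ⟨_, M.edge_vert (M.symm.symm _ _ h), rfl⟩,
        if_pos ⟨_, M.edge_vert h, rfl⟩]
    · rw [h]
  refine Finset.sum_involution (fun x _ => g x) ?_ ?_ ?_ ?_
  · intro x _
    rw [hind]
    exact CharTwo.add_self_eq_zero _
  · intro x _ hx
    rcases hg x with ⟨h1, h2, h⟩ | ⟨h1, h⟩
    · exact fun h' => (M.adj_sub h).ne (Subtype.ext h'.symm)
    · exact absurd (ind_ne_zero.1 hx) h1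
  · intro x hx
    rw [mem_comp] at hx ⊢
    rcases hg x with ⟨h1, h2, h⟩ | ⟨h1, h⟩
    · exact hx.trans (oddGraph_adj.1 (M.adj_sub h)).2
    · rw [h]; exact hx
  · intro x _
    exact hgg x

/-- A set of odd vertices that meets each component of `G - E(H)` evenly can be paired off. -/
lemma matching_of_balanced {H : G.Subgraph} (S : Set (oddVerts H))
    (hS : Balanced (rest H) (ind (Subtype.val '' S))) :
    ∃ M : (oddGraph H).Subgraph, M.IsMatching ∧ M.verts = S := by
  induction hn : S.ncard using Nat.strong_induction_on generalizing S with
  | _ n ih =>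
    obtain rfl | ⟨a, ha⟩ := S.eq_empty_or_nonempty
    · exact ⟨⊥, fun v hv => by simp at hv, rfl⟩
    have ha' : (a : V) ∈ Subtype.val '' S := ⟨a, ha, rfl⟩
    obtain ⟨b', hba, hab, hb'⟩ := exists_second (hS a) (ind_ne_zero.2 ha')
    obtain ⟨b, hb, rfl⟩ := ind_ne_zero.1 hb'
    have hne : a ≠ b := fun h => hba (by rw [h])
    have himg : Subtype.val '' (S \ {a, b}) = (Subtype.val '' S) \ {(a : V), (b : V)} := by
      rw [Set.image_sdiff Subtype.val_injective, Set.image_pair]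
    obtain ⟨M, hM, hMS⟩ := ih _ (hn ▸ Set.ncard_lt_ncard
        ⟨Set.sdiff_subset, fun h => (h ha).2 (by simp)⟩ (Set.toFinite _)) (S \ {a, b}) (by
      rw [himg, ind_diff_pair ha' ⟨b, hb, rfl⟩ hba.symm]
      exact hS.add (balanced_delta hab)) rfl
    have hadj : (oddGraph H).Adj a b := oddGraph_adj.2 ⟨hne, hab⟩
    refine ⟨M ⊔ (oddGraph H).subgraphOfAdj hadj, hM.sup (.subgraphOfAdj hadj) ?_, ?_⟩
    · rw [hM.support_eq_verts, hMS, SimpleGraph.support_subgraphOfAdj]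
      exact Set.disjoint_sdiff_left
    · rw [SimpleGraph.Subgraph.verts_sup, hMS, SimpleGraph.subgraphOfAdj_verts]
      exact Set.sdiff_union_of_subset (by rintro x (rfl | rfl) <;> assumption)

theorem isSEulerian_iff_perfectMatching {H : G.Subgraph} (hH : H.Connected) :
    IsSEulerian H ↔ ∃ M : (oddGraph H).Subgraph, M.IsPerfectMatching := by
  rw [isSEulerian_iff_balanced hH]
  have huniv : (Subtype.val '' (Set.univ : Set (oddVerts H))) = oddVerts H := by simp
  constructor
  · intro h
    obtain ⟨M, hM, hMS⟩ := matching_of_balanced (H := H) Set.univ (by rwa [huniv])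
    exact ⟨M, hM, SimpleGraph.Subgraph.isSpanning_iff.2 hMS⟩
  · rintro ⟨M, hM, hMS⟩
    have := balanced_of_matching hM
    rwa [SimpleGraph.Subgraph.isSpanning_iff.1 hMS, huniv] at this

theorem isSemiSEulerian_iff_matching {H : G.Subgraph} (hH : H.Connected)
    (hT : (oddVerts H).Nonempty) : IsSemiSEulerian H ↔
      ∃ M : (oddGraph H).Subgraph, M.IsMatching ∧ M.vertsᶜ.ncard = 2 := by
  rw [isSemiSEulerian_iff_balanced hH hT]
  have himg : ∀ a b : oddVerts H,
      Subtype.val '' ({a, b}ᶜ : Set (oddVerts H)) = oddVerts H \ {(a : V), (b : V)} := by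
    intro a b
    rw [Set.compl_eq_univ_sdiff, Set.image_sdiff Subtype.val_injective, Set.image_pair]
    simp
  constructor
  · rintro ⟨a, b, hab, ha, hb, h⟩
    have hne : (⟨a, ha⟩ : oddVerts H) ≠ ⟨b, hb⟩ := fun h => hab (congrArg Subtype.val h)
    obtain ⟨M, hM, hMS⟩ := matching_of_balanced (H := H) {⟨a, ha⟩, ⟨b, hb⟩}ᶜ (by rwa [himg])
    exact ⟨M, hM, by rw [hMS, compl_compl, Set.ncard_pair hne]⟩
  · rintro ⟨M, hM, hMS⟩
    obtain ⟨a, b, hab, hMab⟩ := Set.ncard_eq_two.1 hMS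
    refine ⟨a, b, fun h => hab (Subtype.ext h), a.2, b.2, ?_⟩
    have := balanced_of_matching hM
    rwa [← compl_compl M.verts, hMab, himg] at this

end Matching

/-! ### Reasoning about programs -/

namespace Memory

@[simp] lemma setReg_reg (σ : Memory) (x k y : ℕ) :
    (σ.setReg x k).reg y = if y = x then k else σ.reg y := by
  simp [setReg, Function.update_apply]

@[simp] lemma setReg_arr (σ : Memory) (x k : ℕ) : (σ.setReg x k).arr = σ.arr := rfl

@[simp] lemma setArr_reg (σ : Memory) (a i k : ℕ) : (σ.setArr a i k).reg = σ.reg := rfl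

@[simp] lemma setArr_arr (σ : Memory) (a i k b : ℕ) : (σ.setArr a i k).arr b =
    if b = a then Function.update (σ.arr a) i k else σ.arr b := by
  simp [setArr, Function.update_apply]

end Memory

namespace Prog

/-- Programs without loops. -/
def loopFree : Prog → Bool
  | seq P Q => P.loopFree && Q.loopFree
  | ite _ _ P Q => P.loopFree && Q.loopFree
  | loop _ _ _ => false
  | _ => true

/-- The effect of a program without loops (of no significance for other programs). -/
def run : Prog → Memory → Memory
  | skip, σ => σ
  | const x k, σ => σ.setReg x k
  | copy x y, σ => σ.setReg x (σ.reg y)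
  | succ x y, σ => σ.setReg x (σ.reg y + 1)
  | pred x y, σ => σ.setReg x (σ.reg y - 1)
  | load x a y, σ => σ.setReg x (σ.arr a (σ.reg y))
  | store a y x, σ => σ.setArr a (σ.reg y) (σ.reg x)
  | seq P Q, σ => Q.run (P.run σ)
  | ite x y P Q, σ => if σ.reg x < σ.reg y then P.run σ else Q.run σ
  | loop _ _ _, σ => σ

/-- An upper bound for the number of steps of a program without loops. -/
def size : Prog → ℕ
  | seq P Q => P.size + Q.size
  | ite _ _ P Q => max P.size Q.size + 1
  | _ => 1

/-- The registers a program may change. -/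
def regs : Prog → List ℕ
  | const x _ | copy x _ | succ x _ | pred x _ | load x _ _ => [x]
  | seq P Q | ite _ _ P Q => P.regs ++ Q.regs
  | loop _ _ P => P.regs
  | _ => []

/-- The arrays a program may change. -/
def arrs : Prog → List ℕ
  | store a _ _ => [a]
  | seq P Q | ite _ _ P Q => P.arrs ++ Q.arrs
  | loop _ _ P => P.arrs
  | _ => []

end Prog

/-- The memories `σ` and `τ` agree outside the registers and arrays that `P` may change. -/
def Frame (P : Prog) (σ τ : Memory) : Prop :=
  (∀ x, x ∉ P.regs → τ.reg x = σ.reg x) ∧ ∀ a, a ∉ P.arrs → τ.arr a = σ.arr a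

lemma Exec.frame {P : Prog} {σ τ : Memory} {t : ℕ} (h : Exec P σ t τ) : Frame P σ τ := by
  induction h with
  | skip | loop_false => exact ⟨fun _ _ => rfl, fun _ _ => rfl⟩
  | const | copy | succ | pred | load =>
    refine ⟨fun y hy => ?_, fun _ _ => rfl⟩
    simp only [Prog.regs, List.mem_singleton] at hy
    simp [hy]
  | store =>
    refine ⟨fun _ _ => rfl, fun b hb => ?_⟩
    simp only [Prog.arrs, List.mem_singleton] at hb
    simp [hb]
  | seq _ _ ih1 ih2 =>
    constructor <;> intro x hx
    · rw [Prog.regs, List.mem_append, not_or] at hx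
      rw [ih2.1 x hx.2, ih1.1 x hx.1]
    · rw [Prog.arrs, List.mem_append, not_or] at hx
      rw [ih2.2 x hx.2, ih1.2 x hx.1]
  | ite_true _ _ ih =>
    constructor <;> intro x hx
    · rw [Prog.regs, List.mem_append, not_or] at hx
      exact ih.1 x hx.1
    · rw [Prog.arrs, List.mem_append, not_or] at hx
      exact ih.2 x hx.1
  | ite_false _ _ ih =>
    constructor <;> intro x hx
    · rw [Prog.regs, List.mem_append, not_or] at hx
      exact ih.1 x hx.2
    · rw [Prog.arrs, List.mem_append, not_or] at hx
      exact ih.2 x hx.2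
  | loop_true _ _ _ ih1 ih2 =>
    constructor <;> intro x hx
    · rw [ih2.1 x hx, ih1.1 x hx]
    · rw [ih2.2 x hx, ih1.2 x hx]

lemma exec_run (P : Prog) (hP : P.loopFree = true) (σ : Memory) :
    ∃ t ≤ P.size, Exec P σ t (P.run σ) := by
  induction P generalizing σ with
  | skip => exact ⟨1, le_rfl, .skip σ⟩
  | const x k => exact ⟨1, le_rfl, .const x k σ⟩
  | copy x y => exact ⟨1, le_rfl, .copy x y σ⟩
  | succ x y => exact ⟨1, le_rfl, .succ x y σ⟩
  | pred x y => exact ⟨1, le_rfl, .pred x y σ⟩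
  | load x a y => exact ⟨1, le_rfl, .load x a y σ⟩
  | store a y x => exact ⟨1, le_rfl, .store a y x σ⟩
  | seq P Q ihP ihQ =>
    rw [Prog.loopFree, Bool.and_eq_true] at hP
    obtain ⟨s, hs, h1⟩ := ihP hP.1 σ
    obtain ⟨t, ht, h2⟩ := ihQ hP.2 (P.run σ)
    exact ⟨s + t, Nat.add_le_add hs ht, .seq h1 h2⟩
  | ite x y P Q ihP ihQ =>
    rw [Prog.loopFree, Bool.and_eq_true] at hP
    by_cases h : σ.reg x < σ.reg y
    · obtain ⟨s, hs, h1⟩ := ihP hP.1 σ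
      refine ⟨s + 1, Nat.succ_le_succ (hs.trans (le_max_left _ _)), ?_⟩
      rw [Prog.run, if_pos h]
      exact .ite_true h h1
    · obtain ⟨s, hs, h1⟩ := ihQ hP.2 σ
      refine ⟨s + 1, Nat.succ_le_succ (hs.trans (le_max_right _ _)), ?_⟩
      rw [Prog.run, if_neg h]
      exact .ite_false h h1
  | loop => simp [Prog.loopFree] at hP

/-- A loop whose body has no loops and decreases the potential `Φ` takes time linear in `Φ`. -/
lemma exec_loop {x y : ℕ} {P : Prog} (hP : P.loopFree = true) {σ₀ : Memory} (Inv : Memory → Prop)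
    (Φ : Memory → ℕ)
    (hstep : ∀ σ, Frame P σ₀ σ → Inv σ → σ.reg x < σ.reg y →
      Inv (P.run σ) ∧ Φ (P.run σ) < Φ σ) (h0 : Inv σ₀) :
    ∃ t τ, Exec (.loop x y P) σ₀ t τ ∧ t ≤ (P.size + 1) * Φ σ₀ + 1 ∧ Inv τ ∧
      ¬ τ.reg x < τ.reg y := by
  suffices h : ∀ N σ, Φ σ ≤ N → Frame P σ₀ σ → Inv σ → ∃ t τ, Exec (.loop x y P) σ t τ ∧
      t ≤ (P.size + 1) * Φ σ + 1 ∧ Inv τ ∧ ¬ τ.reg x < τ.reg y from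
    h _ σ₀ le_rfl ⟨fun _ _ => rfl, fun _ _ => rfl⟩ h0
  intro N
  induction N with
  | zero =>
    intro σ hΦ hF hI
    by_cases hlt : σ.reg x < σ.reg y
    · have := (hstep σ hF hI hlt).2
      omega
    · exact ⟨1, σ, .loop_false hlt, Nat.le_add_left _ _, hI, hlt⟩
  | succ N ih =>
    intro σ hΦ hF hI
    by_cases hlt : σ.reg x < σ.reg y
    · obtain ⟨hI', hdec⟩ := hstep σ hF hI hlt
      obtain ⟨s, hs, hex⟩ := exec_run P hP σ
      have hF' := hex.frame
      obtain ⟨t, τ, hex', ht, hIτ, hτ⟩ := ih (P.run σ) (by omega)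
        ⟨fun z hz => (hF'.1 z hz).trans (hF.1 z hz), fun a ha => (hF'.2 a ha).trans (hF.2 a ha)⟩
        hI'
      refine ⟨s + t + 1, τ, .loop_true hlt hex hex', ?_, hIτ, hτ⟩
      have : (P.size + 1) * (Φ (P.run σ) + 1) ≤ (P.size + 1) * Φ σ :=
        Nat.mul_le_mul_left _ hdec
      rw [Nat.mul_add, Nat.mul_one] at this
      omega
    · exact ⟨1, σ, .loop_false hlt, Nat.le_add_left _ _, hI, hlt⟩

/-- The rule for counting loops, in which `x` runs from `0` to `N`. -/
lemma exec_for {x y : ℕ} {B : Prog} (hP : B.loopFree = true) {σ₀ : Memory} {N : ℕ}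
    (hx : x ∉ B.regs) (hxy : y ∉ x :: B.regs) (Inv : ℕ → Memory → Prop)
    (hstep : ∀ σ, Frame (B.seq (.succ x x)) σ₀ σ → σ.reg x < N → Inv (σ.reg x) σ →
      Inv (σ.reg x + 1) ((B.run σ).setReg x (σ.reg x + 1)))
    (h0 : Inv 0 σ₀) (hx0 : σ₀.reg x = 0) (hyN : σ₀.reg y = N) :
    ∃ t τ, Exec (.loop x y (B.seq (.succ x x))) σ₀ t τ ∧ t ≤ (B.size + 2) * N + 1 ∧ Inv N τ := by
  have hy' : y ∉ (B.seq (.succ x x)).regs := by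
    simp only [Prog.regs, List.mem_append, List.mem_singleton]
    simpa [and_comm] using hxy
  obtain ⟨t, τ, hex, ht, ⟨hI, hle⟩, hn⟩ := exec_loop (x := x) (y := y) (P := B.seq (.succ x x))
    (by simpa [Prog.loopFree] using hP) (σ₀ := σ₀)
    (fun σ => Inv (σ.reg x) σ ∧ σ.reg x ≤ N) (fun σ => N - σ.reg x) (by
      intro σ hF hI hlt
      have hyσ : σ.reg y = N := (hF.1 y hy').trans hyN
      obtain ⟨s, -, hB⟩ := exec_run B hP σ
      have hxB : (B.run σ).reg x = σ.reg x := hB.frame.1 x hx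
      have := hstep σ hF (by omega) hI.1
      simp only [Prog.run, hxB, Memory.setReg_reg, if_true]
      exact ⟨⟨this, by omega⟩, by omega⟩)
    ⟨by rwa [hx0], by omega⟩
  have hyτ : τ.reg y = N := (hex.frame.1 y hy').trans hyN
  refine ⟨t, τ, hex, ?_, ?_⟩
  · rw [hx0] at ht
    exact ht
  · rwa [show N = τ.reg x by omega]

/-! ### The scan of the edge list

In all programs, registers `0` and `1` hold the numbers of vertices and edges, registers `2` and `9`
the constants `0` and `1`, register `4` is the counter of the counting loops, register `3` the number
of darts stored so far, and registers `5` to `8` are for temporary use. -/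

section Scan

/-- The darts (edges with a direction) of `G - E(H)`, in the order of the edge list. -/
def darts (E : List (ℕ × ℕ × Bool)) : List (ℕ × ℕ) :=
  E.flatMap fun e => if e.2.2 then [] else [(e.1, e.2.1), (e.2.1, e.1)]

/-- The tail of the `j`-th dart. -/
def dartTail (E : List (ℕ × ℕ × Bool)) (j : ℕ) : ℕ := ((darts E).getD j (0, 0)).1

/-- The head of the `j`-th dart. -/
def dartHead (E : List (ℕ × ℕ × Bool)) (j : ℕ) : ℕ := ((darts E).getD j (0, 0)).2

/-- One plus the last place before `j` where `T` takes the value `v`, and `0` if there is none: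
the pointers of the linked lists of darts with a common tail. -/
def lastOcc (T : ℕ → ℕ) (v : ℕ) : ℕ → ℕ
  | 0 => 0
  | j + 1 => if T j = v then j + 1 else lastOcc T v j

lemma lastOcc_le (T : ℕ → ℕ) (v j : ℕ) : lastOcc T v j ≤ j := by
  induction j with
  | zero => rfl
  | succ j ih => rw [lastOcc]; split_ifs <;> omega

lemma ne_of_lastOcc_le {T : ℕ → ℕ} {v i j : ℕ} (h : lastOcc T v j ≤ i) (hij : i < j) :
    T i ≠ v := by
  induction j with
  | zero => omega
  | succ j ih =>
    rw [lastOcc] at h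
    split_ifs at h with hj
    · omega
    · rcases Nat.lt_succ_iff_lt_or_eq.1 hij with h1 | rfl
      · exact ih h h1
      · exact hj

lemma apply_lastOcc {T : ℕ → ℕ} {v j : ℕ} (h : lastOcc T v j ≠ 0) : T (lastOcc T v j - 1) = v := by
  induction j with
  | zero => exact absurd rfl h
  | succ j ih =>
    rw [lastOcc] at h ⊢
    split_ifs at h ⊢ with hj
    · exact hj
    · exact ih h

/-- The degree of `v` modulo two in the edges marked as edges of `H`. -/
def markedParity (E : List (ℕ × ℕ × Bool)) (v : ℕ) : ZMod 2 :=
  (E.map fun e => if e.2.2 then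
    (if v = e.1 then 1 else 0) + (if v = e.2.1 then 1 else 0) else 0).sum

/-- The memory holds the edge list `E`. -/
def Holds (E : List (ℕ × ℕ × Bool)) (σ : Memory) : Prop :=
  ∀ i, (hi : i < E.length) → σ.arr 1 i = E[i].1 ∧ σ.arr 2 i = E[i].2.1 ∧
    σ.arr 3 i = E[i].2.2.toNat

/-- Switch the bit of array `a` whose index stands in register `x`. -/
def toggle (a x : ℕ) : Prog :=
  .seq (.load 8 a x) (.ite 2 8 (.store a x 2) (.store a x 9))

/-- Append a dart: array `8` holds the heads of the darts, array `5` points to the last dart with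
given tail, array `6` points from a dart to the previous one with the same tail. -/
def addDart (x y : ℕ) : Prog :=
  .seq (.store 8 3 y) (.seq (.load 8 5 x) (.seq (.store 6 3 8) (.seq (.succ 3 3) (.store 5 x 3))))

/-- Process one edge: an edge of `H` changes the parities of its ends (array `4`), another edge is
stored as two darts. -/
def scanBody : Prog :=
  .seq (.load 5 1 4) (.seq (.load 6 2 4) (.seq (.load 7 3 4)
    (.ite 2 7
      (.seq (.copy 19 9) (.seq (toggle 4 5) (toggle 4 6)))
      (.seq (addDart 5 6) (addDart 6 5)))))

/-- The invariant of the scan after `i` edges. Register `19` tells whether an edge of `H` has been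
seen. -/
structure ScanInv (E : List (ℕ × ℕ × Bool)) (i : ℕ) (σ : Memory) : Prop where
  odd : ∀ v, σ.arr 4 v = (markedParity (E.take i) v).val
  count : σ.reg 3 = (darts (E.take i)).length
  head : ∀ v, σ.arr 5 v = lastOcc (dartTail E) v (σ.reg 3)
  next : ∀ j < σ.reg 3, σ.arr 6 j = lastOcc (dartTail E) (dartTail E j) j
  target : ∀ j < σ.reg 3, σ.arr 8 j = dartHead E j
  marked : σ.reg 19 = ((E.take i).any (·.2.2)).toNat

lemma take_succ_eq {E : List (ℕ × ℕ × Bool)} {i : ℕ} (hi : i < E.length) :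
    E.take (i + 1) = E.take i ++ [E[i]] := by simp

lemma val_toggle (z : ZMod 2) : (if 0 < z.val then 0 else 1) = (z + 1).val := by
  revert z; decide

lemma markedParity_append (E F : List (ℕ × ℕ × Bool)) (v : ℕ) :
    markedParity (E ++ F) v = markedParity E v + markedParity F v := by
  simp [markedParity]

lemma run_toggle {σ : Memory} {a x : ℕ} (hx : x ≠ 8) (h2 : σ.reg 2 = 0) (h9 : σ.reg 9 = 1)
    (f : ℕ → ZMod 2) (hf : ∀ v, σ.arr a v = (f v).val) :
    (∀ v, ((toggle a x).run σ).arr a v = (f v + if v = σ.reg x then 1 else 0).val) ∧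
    (∀ b, b ≠ a → ((toggle a x).run σ).arr b = σ.arr b) ∧
    ∀ y, y ≠ 8 → ((toggle a x).run σ).reg y = σ.reg y := by
  have h : (toggle a x).run σ = if 0 < (f (σ.reg x)).val then
      (σ.setReg 8 (f (σ.reg x)).val).setArr a (σ.reg x) 0
      else (σ.setReg 8 (f (σ.reg x)).val).setArr a (σ.reg x) 1 := by
    simp [toggle, Prog.run, h2, h9, hf, hx]
  refine ⟨fun v => ?_, fun b hb => ?_, fun y hy => ?_⟩
  · by_cases hv : v = σ.reg x
    · subst hv
      rw [if_pos rfl, ← val_toggle, h]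
      split_ifs <;> simp
    · rw [if_neg hv, add_zero, ← hf, h]
      split_ifs <;> simp [hv]
  · rw [h]; split_ifs <;> simp [hb]
  · rw [h]; split_ifs <;> simp [hy]

lemma darts_take_succ {E : List (ℕ × ℕ × Bool)} {i : ℕ} (hi : i < E.length) :
    darts (E.take (i + 1)) = darts (E.take i) ++
      if E[i].2.2 then [] else [(E[i].1, E[i].2.1), (E[i].2.1, E[i].1)] := by
  rw [take_succ_eq hi, darts, List.flatMap_append]
  simp [darts]

lemma getD_darts {E : List (ℕ × ℕ × Bool)} {i j : ℕ} (hj : j < (darts (E.take i)).length) :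
    (darts E).getD j (0, 0) = (darts (E.take i))[j] := by
  have h : darts E = darts (E.take i) ++ darts (E.drop i) := by
    rw [darts, darts, darts, ← List.flatMap_append, List.take_append_drop]
  rw [h, List.getD_eq_getElem?_getD, List.getElem?_append_left hj]
  simp [hj]

lemma scan_step {E : List (ℕ × ℕ × Bool)} {σ : Memory} {i : ℕ} (hi : i < E.length)
    (hσ : Holds E σ) (h2 : σ.reg 2 = 0) (h9 : σ.reg 9 = 1) (h4 : σ.reg 4 = i)
    (hI : ScanInv E i σ) : ScanInv E (i + 1) (scanBody.run σ) := by
  obtain ⟨hu, hv, hb⟩ := hσ i hi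
  have hpar : ∀ v, markedParity (E.take (i + 1)) v = markedParity (E.take i) v +
      if E[i].2.2 then (if v = E[i].1 then 1 else 0) + (if v = E[i].2.1 then 1 else 0) else 0 := by
    intro v
    rw [take_succ_eq hi, markedParity_append]
    simp [markedParity]
  have hdarts := darts_take_succ hi
  have hany : (E.take (i + 1)).any (·.2.2) = ((E.take i).any (·.2.2) || E[i].2.2) := by
    rw [take_succ_eq hi, List.any_append]; simp
  cases hbit : E[i].2.2 with
  | true =>
    simp only [hbit, if_true, List.append_nil] at hpar hdarts
    rw [hbit] at hb hany
    set σ₁ : Memory := (((σ.setReg 5 E[i].1).setReg 6 E[i].2.1).setReg 7 1).setReg 19 1 with hσ₁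
    have hrun : scanBody.run σ = (toggle 4 6).run ((toggle 4 5).run σ₁) := by
      simp [scanBody, Prog.run, h4, hu, hv, hb, h2, h9, hσ₁]
    obtain ⟨a1, a2, a3⟩ := run_toggle (σ := σ₁) (a := 4) (x := 5) (by decide) (by simp [hσ₁, h2])
      (by simp [hσ₁, h9]) (markedParity (E.take i)) (by simpa [hσ₁] using hI.odd)
    obtain ⟨b1, b2, b3⟩ := run_toggle (σ := (toggle 4 5).run σ₁) (a := 4) (x := 6) (by decide)
      (by rw [a3 _ (by decide)]; simp [hσ₁, h2]) (by rw [a3 _ (by decide)]; simp [hσ₁, h9]) _ a1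
    rw [hrun]
    have hr3 : ((toggle 4 6).run ((toggle 4 5).run σ₁)).reg 3 = σ.reg 3 := by
      rw [b3 _ (by decide), a3 _ (by decide)]; simp [hσ₁]
    have harr : ∀ b, b ≠ 4 → ((toggle 4 6).run ((toggle 4 5).run σ₁)).arr b = σ.arr b := by
      intro b hb
      rw [b2 _ hb, a2 _ hb]; simp [hσ₁]
    refine ⟨fun v => ?_, ?_, ?_, ?_, ?_, ?_⟩
    · rw [b1, hpar, a3 _ (by decide)]
      simp [hσ₁, add_assoc]
    · rw [hr3, hdarts, hI.count]
    · rw [hr3, harr _ (by decide)]; exact hI.head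
    · rw [hr3, harr _ (by decide)]; exact hI.next
    · rw [hr3, harr _ (by decide)]; exact hI.target
    · rw [b3 _ (by decide), a3 _ (by decide), hany]
      simp [hσ₁]
  | false =>
    simp only [hbit, Bool.false_eq_true, if_false, add_zero] at hpar hdarts
    rw [hbit] at hb hany
    set k := σ.reg 3 with hk
    have hkl : (darts (E.take i)).length = k := hI.count.symm
    have hlen : (darts (E.take (i + 1))).length = k + 2 := by
      rw [hdarts, List.length_append, ← hI.count]; rfl
    have hd0 : (darts E).getD k (0, 0) = (E[i].1, E[i].2.1) := by
      rw [getD_darts (i := i + 1) (by omega)]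
      simp only [hdarts]
      rw [List.getElem_append_right (by omega)]
      simp [hkl]
    have hd1 : (darts E).getD (k + 1) (0, 0) = (E[i].2.1, E[i].1) := by
      rw [getD_darts (i := i + 1) (by omega)]
      simp only [hdarts]
      rw [List.getElem_append_right (by omega)]
      simp [hkl]
    have hT0 : dartTail E k = E[i].1 := by rw [dartTail, hd0]
    have hT1 : dartTail E (k + 1) = E[i].2.1 := by rw [dartTail, hd1]
    have hW0 : dartHead E k = E[i].2.1 := by rw [dartHead, hd0]
    have hW1 : dartHead E (k + 1) = E[i].1 := by rw [dartHead, hd1]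
    have hl0 : ∀ v, lastOcc (dartTail E) v (k + 1) =
        if E[i].1 = v then k + 1 else lastOcc (dartTail E) v k := fun v => by
      rw [lastOcc, hT0]
    have hl1 : ∀ v, lastOcc (dartTail E) v (k + 2) =
        if E[i].2.1 = v then k + 2 else lastOcc (dartTail E) v (k + 1) := fun v => by
      rw [lastOcc, hT1]
    have hr3 : (scanBody.run σ).reg 3 = k + 2 := by
      simp [scanBody, addDart, Prog.run, h4, hb, h2, ← hk]
    have hr5 : (scanBody.run σ).arr 5 = Function.update (Function.update (σ.arr 5) E[i].1 (k + 1))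
        E[i].2.1 (k + 2) := by
      simp [scanBody, addDart, Prog.run, h4, hb, h2, hu, hv, ← hk]
    have hr6 : (scanBody.run σ).arr 6 = Function.update (Function.update (σ.arr 6) k
        (σ.arr 5 E[i].1)) (k + 1) (Function.update (σ.arr 5) E[i].1 (k + 1) E[i].2.1) := by
      simp [scanBody, addDart, Prog.run, h4, hb, h2, hu, hv, ← hk]
    have hr8 : (scanBody.run σ).arr 8 = Function.update (Function.update (σ.arr 8) k E[i].2.1)
        (k + 1) E[i].1 := by
      simp [scanBody, addDart, Prog.run, h4, hb, h2, hu, hv, ← hk]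
    refine ⟨fun v => ?_, ?_, ?_, ?_, ?_, ?_⟩
    · rw [hpar, ← hI.odd]
      simp [scanBody, addDart, Prog.run, h4, hb, h2]
    · rw [hr3, hlen]
    · intro v
      rw [hr3, hr5, hl1, hl0, ← hI.head]
      simp only [Function.update_apply, eq_comm]
    · intro j hj
      rw [hr3] at hj
      rw [hr6]
      rcases Nat.lt_succ_iff_lt_or_eq.1 hj with h1 | rfl
      · rcases Nat.lt_succ_iff_lt_or_eq.1 h1 with h1 | rfl
        · simpa [Function.update_apply, (show j ≠ k + 1 by omega), (show j ≠ k by omega)]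
            using hI.next j h1
        · simp [Function.update_apply, hT0, hI.head, ← hk]
      · simp only [Function.update_self, hT1, hl0]
        simp only [Function.update_apply, hI.head, ← hk, eq_comm]
    · intro j hj
      rw [hr3] at hj
      rw [hr8]
      rcases Nat.lt_succ_iff_lt_or_eq.1 hj with h1 | rfl
      · rcases Nat.lt_succ_iff_lt_or_eq.1 h1 with h1 | rfl
        · simpa [Function.update_apply, (show j ≠ k + 1 by omega), (show j ≠ k by omega)]
            using hI.target j h1
        · simp [hW0]
      · simp [hW1]
    · rw [hany, Bool.or_false, ← hI.marked]
      simp [scanBody, addDart, Prog.run, h4, hb, h2]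

end Scan

/-! ### Graph search -/

section Search

/-- A finite symmetric relation on `{0, …, n-1}`, given by darts `T j → W j`, `j < k`. -/
structure DartSystem (n k : ℕ) (T W : ℕ → ℕ) : Prop where
  tail_lt : ∀ j < k, T j < n
  head_lt : ∀ j < k, W j < n
  symm : ∀ j < k, ∃ i < k, T i = W j ∧ W i = T j

/-- Reachability along darts. -/
def Linked (k : ℕ) (T W : ℕ → ℕ) : ℕ → ℕ → Prop :=
  Relation.ReflTransGen fun a b => ∃ j < k, T j = a ∧ W j = b

/-- The invariant of the search. The next root to be tried is `s`, the stack consists of the first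
`h` entries of `S`, the label `c v` of `v` is `0` as long as `v` has not been found, and `p v` points
to the next dart with tail `v` to be followed. -/
structure SearchInv (n k : ℕ) (T W : ℕ → ℕ) (s h : ℕ) (S c p : ℕ → ℕ) : Prop where
  le : s ≤ n
  stack : ∀ i < h, S i < n ∧ c (S i) = s + 1
  label : ∀ v < n, c v ≠ 0 → c v ≤ n ∧ Linked k T W (c v - 1) v
  low : ∀ v < s, c v ≠ 0
  followed : ∀ j < k, p (T j) ≤ j → c (T j) ≠ 0 ∧ c (W j) = c (T j)
  off : ∀ v < n, c v ≠ 0 → (∀ i < h, S i ≠ v) → p v = 0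
  ptr : ∀ v < n, p v ≠ 0 → p v ≤ k ∧ T (p v - 1) = v

/-- The potential of the search: darts to be followed, stack height, twice the number of vertices
to be found, and roots to be tried. -/
def searchPotential (n k : ℕ) (T : ℕ → ℕ) (s h : ℕ) (c p : ℕ → ℕ) : ℕ :=
  ((Finset.range k).filter fun j => j < p (T j)).card + h +
    2 * ((Finset.range n).filter fun v => c v = 0).card + (n - s)

variable {n k : ℕ} {T W : ℕ → ℕ} {s h : ℕ} {S c p : ℕ → ℕ}

lemma SearchInv.stack_lt (hI : SearchInv n k T W s h S c p) (hh : 0 < h) : s < n := by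
  obtain ⟨h1, h2⟩ := hI.stack 0 hh
  have := (hI.label _ h1 (by omega)).1
  omega

/-- The vertex at the head of a dart that leaves the top of the stack, if it has a label at all, has
the label of the current root: if it has left the stack, then the reverse dart has been followed. -/
lemma SearchInv.label_head (hD : DartSystem n k T W) (hI : SearchInv n k T W s h S c p) {e : ℕ}
    (he : e < k) (hc : c (T e) = s + 1) (hw : c (W e) ≠ 0) : c (W e) = s + 1 := by
  by_cases hst : ∀ i < h, S i ≠ W e
  · obtain ⟨i, hi, h1, h2⟩ := hD.symm e he
    have hoff := hI.off _ (hD.head_lt e he) hw hst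
    have := (hI.followed i hi (by rw [h1, hoff]; exact Nat.zero_le _)).2
    rw [h1, h2] at this
    omega
  · push Not at hst
    obtain ⟨i, hi, h1⟩ := hst
    rw [← h1]
    exact (hI.stack i hi).2

/-- Moving the pointer of `v = T e` past the dart `e`. -/
lemma pointer_followed {e : ℕ} (hpe : p (T e) = e + 1) {j : ℕ}
    (hle : Function.update p (T e) (lastOcc T (T e) e) (T j) ≤ j) :
    p (T j) ≤ j ∨ j = e := by
  by_cases hv : T j = T e
  · rw [hv, Function.update_self] at hle
    rw [hv, hpe]
    by_contra! hcon
    exact ne_of_lastOcc_le hle (by omega) hv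
  · rw [Function.update_of_ne hv] at hle
    exact Or.inl hle

lemma pointer_ptr (hI : SearchInv n k T W s h S c p) {e : ℕ} (he : e < k) :
    ∀ v < n, Function.update p (T e) (lastOcc T (T e) e) v ≠ 0 →
      Function.update p (T e) (lastOcc T (T e) e) v ≤ k ∧
      T (Function.update p (T e) (lastOcc T (T e) e) v - 1) = v := by
  intro v hv
  by_cases hvT : v = T e
  · subst hvT
    rw [Function.update_self]
    intro h0
    exact ⟨(lastOcc_le _ _ _).trans he.le, apply_lastOcc h0⟩
  · rw [Function.update_of_ne hvT]
    exact hI.ptr v hv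

lemma pointer_card_lt {e : ℕ} (he : e < k) (hpe : p (T e) = e + 1) :
    ((Finset.range k).filter fun j =>
      j < Function.update p (T e) (lastOcc T (T e) e) (T j)).card <
    ((Finset.range k).filter fun j => j < p (T j)).card := by
  refine Finset.card_lt_card ((Finset.ssubset_iff_of_subset fun j hj => ?_).2 ⟨e, ?_, ?_⟩)
  · rw [Finset.mem_filter] at hj ⊢
    refine ⟨hj.1, ?_⟩
    have := hj.2
    by_cases hv : T j = T e
    · rw [hv, Function.update_self] at this
      rw [hv, hpe]
      have := lastOcc_le T (T e) e
      omega
    · rwa [Function.update_of_ne hv] at this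
  · simpa [hpe] using he
  · simpa using fun _ => lastOcc_le T (T e) e

lemma unfound_card_lt {w x : ℕ} (hw : w < n) (hc : c w = 0) (hx : x ≠ 0) :
    ((Finset.range n).filter fun v => Function.update c w x v = 0).card <
    ((Finset.range n).filter fun v => c v = 0).card := by
  refine Finset.card_lt_card ((Finset.ssubset_iff_of_subset fun v hv => ?_).2 ⟨w, ?_, ?_⟩)
  · rw [Finset.mem_filter] at hv ⊢
    refine ⟨hv.1, ?_⟩
    have := hv.2
    by_cases hvw : v = w
    · rwa [hvw]
    · rwa [Function.update_of_ne hvw] at this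
  · simpa [hc] using hw
  · simp [hx]

lemma SearchInv.follow_old (hD : DartSystem n k T W) (hI : SearchInv n k T W s h S c p) {e : ℕ}
    (he : e < k) (hpe : p (T e) = e + 1) (hh : 0 < h) (htop : S (h - 1) = T e)
    (hw : c (W e) ≠ 0) :
    SearchInv n k T W s h S c (Function.update p (T e) (lastOcc T (T e) e)) := by
  have hc : c (T e) = s + 1 := by rw [← htop]; exact (hI.stack _ (by omega)).2
  refine ⟨hI.le, hI.stack, hI.label, hI.low, fun j hj hle => ?_, fun v hv hcv hst => ?_,
    pointer_ptr hI he⟩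
  · rcases pointer_followed hpe hle with h1 | rfl
    · exact hI.followed j hj h1
    · exact ⟨by omega, (hI.label_head hD he hc hw).trans hc.symm⟩
  · rw [Function.update_of_ne]
    · exact hI.off v hv hcv hst
    · rintro rfl
      exact hst _ (by omega) htop

lemma SearchInv.follow_new (hD : DartSystem n k T W) (hI : SearchInv n k T W s h S c p) {e : ℕ}
    (he : e < k) (hpe : p (T e) = e + 1) (hh : 0 < h) (htop : S (h - 1) = T e)
    (hw : c (W e) = 0) :
    SearchInv n k T W s (h + 1) (Function.update S h (W e)) (Function.update c (W e) (c (T e)))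
      (Function.update p (T e) (lastOcc T (T e) e)) := by
  have hc : c (T e) = s + 1 := by rw [← htop]; exact (hI.stack _ (by omega)).2
  have hne : T e ≠ W e := fun h' => by rw [h'] at hc; omega
  have hold : ∀ v, c v ≠ 0 → Function.update c (W e) (c (T e)) v = c v := fun v hv =>
    Function.update_of_ne (fun h' => hv (by rw [h']; exact hw)) _ _
  refine ⟨hI.le, fun i hi => ?_, fun v hv hcv => ?_, fun v hv => ?_, fun j hj hle => ?_,
    fun v hv hcv hst => ?_, pointer_ptr hI he⟩
  · rcases Nat.lt_succ_iff_lt_or_eq.1 hi with h1 | rfl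
    · rw [Function.update_of_ne h1.ne]
      obtain ⟨h2, h3⟩ := hI.stack i h1
      exact ⟨h2, by rw [hold _ (by omega), h3]⟩
    · rw [Function.update_self, Function.update_self]
      exact ⟨hD.head_lt e he, hc⟩
  · by_cases hvw : v = W e
    · subst hvw
      rw [Function.update_self]
      obtain ⟨h1, h2⟩ := hI.label (T e) (hD.tail_lt e he) (by omega)
      exact ⟨h1, h2.tail ⟨e, he, rfl, rfl⟩⟩
    · rw [Function.update_of_ne hvw] at hcv ⊢
      exact hI.label v hv hcv
  · rw [hold _ (hI.low v hv)]
    exact hI.low v hv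
  · rcases pointer_followed hpe hle with h1 | rfl
    · obtain ⟨h2, h3⟩ := hI.followed j hj h1
      rw [hold _ h2, hold _ (by rwa [h3])]
      exact ⟨h2, h3⟩
    · rw [Function.update_self, hold _ (by omega)]
      exact ⟨by omega, rfl⟩
  · have hvw : v ≠ W e := fun h' => hst h (by omega) (by rw [Function.update_self, h'])
    rw [Function.update_of_ne hvw] at hcv
    have hst' : ∀ i < h, S i ≠ v := fun i hi => by
      have := hst i (by omega)
      rwa [Function.update_of_ne hi.ne] at this
    rw [Function.update_of_ne]
    · exact hI.off v hv hcv hst'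
    · rintro rfl
      exact hst' _ (by omega) htop

lemma SearchInv.pop (hI : SearchInv n k T W s h S c p) (hp : p (S (h - 1)) = 0) :
    SearchInv n k T W s (h - 1) S c p := by
  refine ⟨hI.le, fun i hi => hI.stack i (by omega), hI.label, hI.low, hI.followed,
    fun v hv hcv hst => ?_, hI.ptr⟩
  by_cases hv' : S (h - 1) = v
  · rwa [← hv']
  · refine hI.off v hv hcv fun i hi => ?_
    by_cases hi' : i = h - 1
    · rwa [hi']
    · exact hst i (by omega)

lemma SearchInv.next_root (hI : SearchInv n k T W s 0 S c p) (hs : s < n) (hc : c s ≠ 0) :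
    SearchInv n k T W (s + 1) 0 S c p := by
  refine ⟨hs, fun i hi => by omega, hI.label, fun v hv => ?_, hI.followed, hI.off, hI.ptr⟩
  rcases Nat.lt_succ_iff_lt_or_eq.1 hv with h1 | rfl
  · exact hI.low v h1
  · exact hc

lemma SearchInv.new_root (hI : SearchInv n k T W s 0 S c p)
    (hs : s < n) (hc : c s = 0) :
    SearchInv n k T W s 1 (Function.update S 0 s) (Function.update c s (s + 1)) p := by
  have hold : ∀ v, c v ≠ 0 → Function.update c s (s + 1) v = c v := fun v hv =>
    Function.update_of_ne (fun h' => hv (by rw [h']; exact hc)) _ _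
  refine ⟨hI.le, fun i hi => ?_, fun v hv hcv => ?_, fun v hv => ?_, fun j hj hle => ?_,
    fun v hv hcv hst => ?_, hI.ptr⟩
  · obtain rfl : i = 0 := by omega
    simpa using hs
  · by_cases hvs : v = s
    · subst hvs
      rw [Function.update_self]
      exact ⟨hs, .refl⟩
    · rw [Function.update_of_ne hvs] at hcv ⊢
      exact hI.label v hv hcv
  · rw [hold _ (hI.low v hv)]
    exact hI.low v hv
  · obtain ⟨h2, h3⟩ := hI.followed j hj hle
    rw [hold _ h2, hold _ (by rwa [h3])]
    exact ⟨h2, h3⟩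
  · have hvs : v ≠ s := fun h' => hst 0 (by omega) (by rw [Function.update_self, h'])
    rw [Function.update_of_ne hvs] at hcv
    exact hI.off v hv hcv fun i hi => by omega

/-- At the end of the search, the labels tell the components apart. -/
lemma SearchInv.final (hD : DartSystem n k T W) (hI : SearchInv n k T W s h S c p) (hs : n ≤ s) :
    (∀ v < n, 1 ≤ c v ∧ c v ≤ n) ∧
    ∀ u < n, ∀ v < n, c u = c v ↔ Linked k T W u v := by
  have hh : h = 0 := by
    by_contra hh
    have := hI.stack_lt (Nat.pos_of_ne_zero hh)
    omega
  subst hh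
  have hlow : ∀ v < n, c v ≠ 0 := fun v hv => hI.low v (by omega)
  have hoff : ∀ v < n, p v = 0 := fun v hv => hI.off v hv (hlow v hv) fun i hi => by omega
  have hdart : ∀ j < k, c (W j) = c (T j) := fun j hj =>
    (hI.followed j hj (by rw [hoff _ (hD.tail_lt j hj)]; exact Nat.zero_le _)).2
  have hsymm : ∀ {u v}, Linked k T W u v → Linked k T W v u := by
    intro u v huv
    induction huv with
    | refl => exact .refl
    | tail _ hbc ih =>
      obtain ⟨j, hj, rfl, rfl⟩ := hbc
      exact .head (hD.symm j hj) ih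
  refine ⟨fun v hv => ⟨Nat.pos_of_ne_zero (hlow v hv), (hI.label v hv (hlow v hv)).1⟩,
    fun u hu v hv => ⟨fun huv => ?_, fun huv => ?_⟩⟩
  · have h1 := (hI.label u hu (hlow u hu)).2
    have h2 := (hI.label v hv (hlow v hv)).2
    rw [huv] at h1
    exact (hsymm h1).trans h2
  · clear hv
    induction huv with
    | refl => rfl
    | tail _ hbc ih =>
      obtain ⟨j, hj, rfl, rfl⟩ := hbc
      rw [hdart j hj]
      exact ih

/-- One step of the search: follow a dart from the top of the stack, or pop the stack, or go to the
next root. Register `10` holds the root, register `11` the height of the stack, array `9` the labels,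
array `10` the stack; the pointers of array `5` advance along the linked lists in array `6`. -/
def searchBody : Prog :=
  .ite 2 11
    (.seq (.pred 8 11) (.seq (.load 12 10 8) (.seq (.load 13 5 12)
      (.ite 2 13
        (.seq (.pred 14 13) (.seq (.load 8 6 14) (.seq (.store 5 12 8) (.seq (.load 15 8 14)
          (.seq (.load 8 9 15)
            (.ite 2 8 .skip
              (.seq (.load 8 9 12) (.seq (.store 9 15 8) (.seq (.store 10 11 15)
                (.succ 11 11))))))))))
        (.pred 11 11)))))
    (.seq (.load 8 9 10)
      (.ite 2 8 (.succ 10 10)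
        (.seq (.succ 8 10) (.seq (.store 9 10 8) (.seq (.store 10 11 10) (.succ 11 11))))))

/-- `SearchInv` for the contents of a memory. -/
def SearchMem (n k : ℕ) (T W : ℕ → ℕ) (σ : Memory) : Prop :=
  SearchInv n k T W (σ.reg 10) (σ.reg 11) (σ.arr 10) (σ.arr 9) (σ.arr 5)

/-- `searchPotential` for the contents of a memory. -/
def searchPotentialMem (n k : ℕ) (T : ℕ → ℕ) (σ : Memory) : ℕ :=
  searchPotential n k T (σ.reg 10) (σ.reg 11) (σ.arr 9) (σ.arr 5)

lemma search_step (hD : DartSystem n k T W) {σ : Memory} (h2 : σ.reg 2 = 0)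
    (hnext : ∀ j < k, σ.arr 6 j = lastOcc T (T j) j) (hhead : ∀ j < k, σ.arr 8 j = W j)
    (hs : σ.reg 10 < n) (hI : SearchMem n k T W σ) :
    SearchMem n k T W (searchBody.run σ) ∧
      searchPotentialMem n k T (searchBody.run σ) < searchPotentialMem n k T σ := by
  unfold SearchMem searchPotentialMem at *
  by_cases hh : 0 < σ.reg 11
  · set v := σ.arr 10 (σ.reg 11 - 1) with hv
    have hvn : v < n := (hI.stack _ (by omega)).1
    by_cases hp : σ.arr 5 v = 0
    · have h10 : (searchBody.run σ).reg 10 = σ.reg 10 := by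
        simp [searchBody, Prog.run, h2, hh, ← hv, hp]
      have h11 : (searchBody.run σ).reg 11 = σ.reg 11 - 1 := by
        simp [searchBody, Prog.run, h2, hh, ← hv, hp]
      have harr : (searchBody.run σ).arr = σ.arr := by
        simp [searchBody, Prog.run, h2, hh, ← hv, hp]
      rw [h10, h11, harr]
      refine ⟨hI.pop hp, ?_⟩
      unfold searchPotential
      omega
    · obtain ⟨e, hpe⟩ := Nat.exists_eq_succ_of_ne_zero hp
      obtain ⟨hle, hTe⟩ := hI.ptr v hvn hp
      rw [hpe, Nat.succ_sub_one] at hTe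
      have he : e < k := by omega
      rw [← hTe] at hpe
      by_cases hw : σ.arr 9 (W e) = 0
      · have h10 : (searchBody.run σ).reg 10 = σ.reg 10 := by
          simp [searchBody, Prog.run, h2, hh, ← hv, ← hTe, hpe, hnext e he, hhead e he, hw]
        have h11 : (searchBody.run σ).reg 11 = σ.reg 11 + 1 := by
          simp [searchBody, Prog.run, h2, hh, ← hv, ← hTe, hpe, hnext e he, hhead e he, hw]
        have ha5 : (searchBody.run σ).arr 5 =
            Function.update (σ.arr 5) (T e) (lastOcc T (T e) e) := by
          simp [searchBody, Prog.run, h2, hh, ← hv, ← hTe, hpe, hnext e he, hhead e he, hw]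
        have ha9 : (searchBody.run σ).arr 9 =
            Function.update (σ.arr 9) (W e) (σ.arr 9 (T e)) := by
          simp [searchBody, Prog.run, h2, hh, ← hv, ← hTe, hpe, hnext e he, hhead e he, hw]
        have ha10 : (searchBody.run σ).arr 10 =
            Function.update (σ.arr 10) (σ.reg 11) (W e) := by
          simp [searchBody, Prog.run, h2, hh, ← hv, ← hTe, hpe, hnext e he, hhead e he, hw]
        rw [h10, h11, ha5, ha9, ha10]
        refine ⟨hI.follow_new hD he hpe hh (hv.symm.trans hTe.symm) hw, ?_⟩
        have hc : σ.arr 9 (T e) ≠ 0 := by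
          rw [hTe, hv, (hI.stack _ (by omega)).2]; omega
        have h1 := pointer_card_lt he hpe
        have h2 := unfound_card_lt (hD.head_lt e he) hw hc
        unfold searchPotential
        omega
      · have hpos : 0 < σ.arr 9 (W e) := Nat.pos_of_ne_zero hw
        have h10 : (searchBody.run σ).reg 10 = σ.reg 10 := by
          simp [searchBody, Prog.run, h2, hh, ← hv, ← hTe, hpe, hnext e he, hhead e he, hpos]
        have h11 : (searchBody.run σ).reg 11 = σ.reg 11 := by
          simp [searchBody, Prog.run, h2, hh, ← hv, ← hTe, hpe, hnext e he, hhead e he, hpos]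
        have ha5 : (searchBody.run σ).arr 5 =
            Function.update (σ.arr 5) (T e) (lastOcc T (T e) e) := by
          simp [searchBody, Prog.run, h2, hh, ← hv, ← hTe, hpe, hnext e he, hhead e he, hpos]
        have ha9 : (searchBody.run σ).arr 9 = σ.arr 9 := by
          simp [searchBody, Prog.run, h2, hh, ← hv, ← hTe, hpe, hnext e he, hhead e he, hpos]
        have ha10 : (searchBody.run σ).arr 10 = σ.arr 10 := by
          simp [searchBody, Prog.run, h2, hh, ← hv, ← hTe, hpe, hnext e he, hhead e he, hpos]
        rw [h10, h11, ha5, ha9, ha10]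
        refine ⟨hI.follow_old hD he hpe hh (hv.symm.trans hTe.symm) hw, ?_⟩
        have h1 := pointer_card_lt he hpe
        unfold searchPotential
        omega
  · have hh0 : σ.reg 11 = 0 := by omega
    rw [hh0] at hI
    by_cases hc : σ.arr 9 (σ.reg 10) = 0
    · have h10 : (searchBody.run σ).reg 10 = σ.reg 10 := by
        simp [searchBody, Prog.run, h2, hh0, hc]
      have h11 : (searchBody.run σ).reg 11 = 1 := by
        simp [searchBody, Prog.run, h2, hh0, hc]
      have ha5 : (searchBody.run σ).arr 5 = σ.arr 5 := by
        simp [searchBody, Prog.run, h2, hh0, hc]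
      have ha9 : (searchBody.run σ).arr 9 =
          Function.update (σ.arr 9) (σ.reg 10) (σ.reg 10 + 1) := by
        simp [searchBody, Prog.run, h2, hh0, hc]
      have ha10 : (searchBody.run σ).arr 10 = Function.update (σ.arr 10) 0 (σ.reg 10) := by
        simp [searchBody, Prog.run, h2, hh0, hc]
      rw [h10, h11, ha5, ha9, ha10, hh0]
      refine ⟨hI.new_root hs hc, ?_⟩
      have h2 := unfound_card_lt hs hc (Nat.add_one_ne_zero (σ.reg 10))
      unfold searchPotential
      omega
    · have hpos : 0 < σ.arr 9 (σ.reg 10) := Nat.pos_of_ne_zero hc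
      have h10 : (searchBody.run σ).reg 10 = σ.reg 10 + 1 := by
        simp [searchBody, Prog.run, h2, hh0, hpos]
      have h11 : (searchBody.run σ).reg 11 = 0 := by
        simp [searchBody, Prog.run, h2, hh0, hpos]
      have harr : (searchBody.run σ).arr = σ.arr := by
        simp [searchBody, Prog.run, h2, hh0, hpos]
      rw [h10, h11, harr, hh0]
      refine ⟨hI.next_root hs hc, ?_⟩
      unfold searchPotential
      omega

/-- The search computes labels of the components in linear time. -/
lemma exec_search (hD : DartSystem n k T W) {σ : Memory} (h0 : σ.reg 0 = n) (h2 : σ.reg 2 = 0)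
    (h10 : σ.reg 10 = 0) (h11 : σ.reg 11 = 0) (h5 : ∀ v, σ.arr 5 v = lastOcc T v k)
    (hnext : ∀ j < k, σ.arr 6 j = lastOcc T (T j) j) (hhead : ∀ j < k, σ.arr 8 j = W j)
    (h9 : ∀ v, σ.arr 9 v = 0) :
    ∃ t τ, Exec (.loop 10 0 searchBody) σ t τ ∧ t ≤ 17 * (k + 3 * n) + 1 ∧
      (∀ v < n, 1 ≤ τ.arr 9 v ∧ τ.arr 9 v ≤ n) ∧
      ∀ u < n, ∀ v < n, τ.arr 9 u = τ.arr 9 v ↔ Linked k T W u v := by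
  obtain ⟨t, τ, hex, ht, hI, hn⟩ := exec_loop (x := 10) (y := 0) (P := searchBody) rfl (σ₀ := σ)
    (SearchMem n k T W) (searchPotentialMem n k T)
    (fun ρ hF hI hlt => search_step hD ((hF.1 2 (by decide)).trans h2)
      (by rwa [hF.2 6 (by decide)]) (by rwa [hF.2 8 (by decide)])
      (by rwa [hF.1 0 (by decide), h0] at hlt) hI)
    (by
      unfold SearchMem
      rw [h10, h11]
      refine ⟨Nat.zero_le _, by simp, fun v _ hv => absurd (h9 v) hv, by simp,
        fun j hj hle => ?_, fun v _ hv => absurd (h9 v) hv, fun v _ hv => ?_⟩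
      · rw [h5] at hle
        exact absurd rfl (ne_of_lastOcc_le hle hj)
      · rw [h5] at hv ⊢
        exact ⟨lastOcc_le _ _ _, apply_lastOcc hv⟩)
  refine ⟨t, τ, hex, ht.trans ?_, ?_⟩
  · have hΦ : searchPotentialMem n k T σ ≤ k + 3 * n := by
      unfold searchPotentialMem searchPotential
      have h1 := (Finset.card_filter_le (Finset.range k) fun j => j < σ.arr 5 (T j))
      have h2 := (Finset.card_filter_le (Finset.range n) fun v => σ.arr 9 v = 0)
      rw [Finset.card_range] at h1 h2
      omega
    have hsize : searchBody.size + 1 ≤ 17 := by decide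
    exact Nat.succ_le_succ (Nat.mul_le_mul hsize hΦ)
  · have h0' : τ.reg 0 = n := (hex.frame.1 0 (by decide)).trans h0
    exact hI.final hD (by omega)

end Search

/-! ### The programs -/

section Programs

lemma Holds.congr {E : List (ℕ × ℕ × Bool)} {σ τ : Memory} (hσ : Holds E σ)
    (h1 : τ.arr 1 = σ.arr 1) (h2 : τ.arr 2 = σ.arr 2) (h3 : τ.arr 3 = σ.arr 3) : Holds E τ := by
  unfold Holds
  rw [h1, h2, h3]
  exact hσ

lemma holds_initial (I : Code) : Holds I.2 (initial I) := by
  intro i hi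
  simp [initial, hi]

lemma exec_scan {E : List (ℕ × ℕ × Bool)} {σ : Memory} (hσ : Holds E σ) (h1 : σ.reg 1 = E.length)
    (h2 : σ.reg 2 = 0) (h3 : σ.reg 3 = 0) (h4 : σ.reg 4 = 0) (h9 : σ.reg 9 = 1)
    (h19 : σ.reg 19 = 0) (ha4 : ∀ v, σ.arr 4 v = 0) (ha5 : ∀ v, σ.arr 5 v = 0) :
    ∃ t τ, Exec (.loop 4 1 (scanBody.seq (.succ 4 4))) σ t τ ∧ t ≤ 17 * E.length + 1 ∧
      ScanInv E E.length τ := by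
  obtain ⟨t, τ, hex, ht, hI⟩ := exec_for (x := 4) (y := 1) (B := scanBody) rfl (σ₀ := σ)
    (N := E.length) (by decide) (by decide) (ScanInv E)
    (fun ρ hF hlt hI => by
      have hstep := scan_step hlt (hσ.congr (hF.2 1 (by decide)) (hF.2 2 (by decide))
        (hF.2 3 (by decide))) ((hF.1 2 (by decide)).trans h2) ((hF.1 9 (by decide)).trans h9) rfl hI
      exact ⟨by simpa using hstep.odd, by simpa using hstep.count, by simpa using hstep.head,
        by simpa using hstep.next, by simpa using hstep.target, by simpa using hstep.marked⟩)
    ⟨by simp [ha4, markedParity], by simp [h3, darts], by simp [ha5, h3, lastOcc], by simp [h3],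
      by simp [h3], by simp [h19]⟩ h4 h1
  exact ⟨t, τ, hex, ht.trans (Nat.succ_le_succ (Nat.mul_le_mul_right _ (by decide))), hI⟩

/-- The sum of the parities `f v` over the vertices `v < i` with label `l`. -/
def labelSum (f : ℕ → ZMod 2) (c : ℕ → ℕ) (i l : ℕ) : ZMod 2 :=
  ∑ v ∈ Finset.range i, if c v = l then f v else 0

/-- Add the parity of one vertex to the parity of its label (array `11`), and record in register
`17` whether there is an odd vertex. -/
def sumBody : Prog :=
  .seq (.load 7 4 4) (.ite 2 7 (.seq (.copy 17 9) (.seq (.load 5 9 4) (toggle 11 5))) .skip)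

lemma val_pos_iff {z : ZMod 2} : 0 < z.val ↔ z ≠ 0 := by revert z; decide

lemma exec_sum {n : ℕ} {f : ℕ → ZMod 2} {σ : Memory} (h0 : σ.reg 0 = n) (h2 : σ.reg 2 = 0)
    (h4 : σ.reg 4 = 0) (h9 : σ.reg 9 = 1) (h17 : σ.reg 17 = 0)
    (ha4 : ∀ v, σ.arr 4 v = (f v).val) (ha11 : ∀ v, σ.arr 11 v = 0) :
    ∃ t τ, Exec (.loop 4 0 (sumBody.seq (.succ 4 4))) σ t τ ∧ t ≤ 10 * n + 1 ∧
      (∀ l, τ.arr 11 l = (labelSum f (σ.arr 9) n l).val) ∧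
      ((∃ v < n, f v ≠ 0) → τ.reg 17 = 1) ∧ ((∀ v < n, f v = 0) → τ.reg 17 = 0) := by
  obtain ⟨t, τ, hex, ht, hI⟩ := exec_for (x := 4) (y := 0) (B := sumBody) rfl (σ₀ := σ)
    (N := n) (by decide) (by decide)
    (fun i ρ => (∀ l, ρ.arr 11 l = (labelSum f (σ.arr 9) i l).val) ∧
      ((∃ v < i, f v ≠ 0) → ρ.reg 17 = 1) ∧ ((∀ v < i, f v = 0) → ρ.reg 17 = 0))
    (fun ρ hF hlt hI => by
      set i := ρ.reg 4 with hi
      obtain ⟨hI1, hI2, hI3⟩ := hI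
      have hρ2 : ρ.reg 2 = 0 := (hF.1 2 (by decide)).trans h2
      have hρ9 : ρ.reg 9 = 1 := (hF.1 9 (by decide)).trans h9
      have hb4 : ∀ v, ρ.arr 4 v = (f v).val := by rwa [hF.2 4 (by decide)]
      have hb9 : ρ.arr 9 = σ.arr 9 := hF.2 9 (by decide)
      have hsum : ∀ l, labelSum f (σ.arr 9) (i + 1) l =
          labelSum f (σ.arr 9) i l + if σ.arr 9 i = l then f i else 0 := fun l =>
        Finset.sum_range_succ _ _
      by_cases hf : f i = 0
      · have hrun : sumBody.run ρ = ρ.setReg 7 0 := by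
          simp [sumBody, Prog.run, ← hi, hb4, hf, hρ2]
        rw [hrun]
        refine ⟨fun l => ?_, fun ⟨v, hv, hfv⟩ => ?_, fun h => ?_⟩
        · rw [hsum, hf]; simpa using hI1 l
        · rcases Nat.lt_succ_iff_lt_or_eq.1 hv with h1 | rfl
          · simpa using hI2 ⟨v, h1, hfv⟩
          · exact absurd hf hfv
        · simpa using hI3 fun v hv => h v (by omega)
      · have hpos : 0 < (f i).val := val_pos_iff.2 hf
        set ρ₁ : Memory := ((ρ.setReg 7 (f i).val).setReg 17 1).setReg 5 (σ.arr 9 i) with hρ₁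
        have hrun : sumBody.run ρ = (toggle 11 5).run ρ₁ := by
          simp [sumBody, Prog.run, ← hi, hb4, hb9, hpos, hρ2, hρ9, hρ₁]
        obtain ⟨a1, a2, a3⟩ := run_toggle (σ := ρ₁) (a := 11) (x := 5) (by decide)
          (by simp [hρ₁, hρ2]) (by simp [hρ₁, hρ9]) (labelSum f (σ.arr 9) i)
          (by simpa [hρ₁] using hI1)
        rw [hrun]
        refine ⟨fun l => ?_, fun _ => ?_, fun h => absurd (h i (by omega)) hf⟩
        · rw [Memory.setReg_arr, a1, hsum, zmod_two_eq_one hf]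
          simp [hρ₁, eq_comm]
        · rw [Memory.setReg_reg, if_neg (by decide), a3 _ (by decide)]
          simp [hρ₁])
    ⟨fun l => by simp [ha11, labelSum], fun ⟨v, hv, _⟩ => by omega, fun _ => h17⟩ h4 h0
  exact ⟨t, τ, hex, ht.trans (Nat.succ_le_succ (Nat.mul_le_mul_right _ (by decide))), hI⟩

/-- The labels, less one, of odd sum. -/
def oddLabels (f : ℕ → ZMod 2) (c : ℕ → ℕ) (n : ℕ) : Finset ℕ :=
  (Finset.range n).filter fun l => labelSum f c n (l + 1) ≠ 0

/-- Count a label if its sum is odd. -/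
def countBody : Prog :=
  .seq (.succ 8 4) (.seq (.load 7 11 8) (.ite 2 7 (.succ 18 18) .skip))

lemma exec_count {n : ℕ} {g : ℕ → ZMod 2} {σ : Memory} (h0 : σ.reg 0 = n) (h2 : σ.reg 2 = 0)
    (h4 : σ.reg 4 = 0) (h18 : σ.reg 18 = 0) (ha11 : ∀ l, σ.arr 11 l = (g l).val) :
    ∃ t τ, Exec (.loop 4 0 (countBody.seq (.succ 4 4))) σ t τ ∧ t ≤ 6 * n + 1 ∧
      τ.reg 18 = ((Finset.range n).filter fun l => g (l + 1) ≠ 0).card := by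
  obtain ⟨t, τ, hex, ht, hI⟩ := exec_for (x := 4) (y := 0) (B := countBody) rfl (σ₀ := σ)
    (N := n) (by decide) (by decide)
    (fun i ρ => ρ.reg 18 = ((Finset.range i).filter fun l => g (l + 1) ≠ 0).card)
    (fun ρ hF hlt hI => by
      set i := ρ.reg 4 with hi
      have hρ2 : ρ.reg 2 = 0 := (hF.1 2 (by decide)).trans h2
      have hb : ∀ l, ρ.arr 11 l = (g l).val := by rwa [hF.2 11 (by decide)]
      rw [Finset.range_add_one, Finset.filter_insert]
      by_cases hg : g (i + 1) = 0
      · rw [if_neg (by simpa using hg), ← hI]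
        simp [countBody, Prog.run, ← hi, hb, hg, hρ2]
      · have hpos : 0 < (g (i + 1)).val := val_pos_iff.2 hg
        rw [if_pos hg, Finset.card_insert_of_notMem (by simp), ← hI]
        simp [countBody, Prog.run, ← hi, hb, hpos, hρ2])
    (by simpa using h18) h4 h0
  exact ⟨t, τ, hex, ht.trans (Nat.succ_le_succ (Nat.mul_le_mul_right _ (by decide))), hI⟩

/-- The part common to both decision programs: register `18` counts the components of `G - E(H)`
with an odd number of odd vertices of `H`. -/
def countOddComponents : Prog :=
  .seq (.const 9 1) (.seq (.loop 4 1 (scanBody.seq (.succ 4 4)))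
    (.seq (.loop 10 0 searchBody) (.seq (.const 4 0) (.seq (.loop 4 0 (sumBody.seq (.succ 4 4)))
      (.seq (.const 4 0) (.loop 4 0 (countBody.seq (.succ 4 4))))))))

lemma length_darts_le (E : List (ℕ × ℕ × Bool)) : (darts E).length ≤ 2 * E.length := by
  induction E with
  | nil => simp [darts]
  | cons e E ih =>
    have : darts (e :: E) = (if e.2.2 then [] else [(e.1, e.2.1), (e.2.1, e.1)]) ++ darts E := by
      simp [darts]
    rw [this, List.length_append, List.length_cons]
    split_ifs <;> simp <;> omega

lemma exec_countOddComponents (I : Code)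
    (hD : DartSystem I.1.length (darts I.2).length (dartTail I.2) (dartHead I.2)) :
    ∃ t τ c, Exec countOddComponents (initial I) t τ ∧
      t ≤ 51 * I.2.length + 67 * I.1.length + 7 ∧
      (∀ v < I.1.length, 1 ≤ c v ∧ c v ≤ I.1.length) ∧
      (∀ u < I.1.length, ∀ v < I.1.length, c u = c v ↔
        Linked (darts I.2).length (dartTail I.2) (dartHead I.2) u v) ∧
      τ.reg 18 = (oddLabels (markedParity I.2) c I.1.length).card ∧
      ((∃ v < I.1.length, markedParity I.2 v ≠ 0) → τ.reg 17 = 1) ∧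
      ((∀ v < I.1.length, markedParity I.2 v = 0) → τ.reg 17 = 0) ∧
      τ.reg 19 = (I.2.any (·.2.2)).toNat ∧ τ.reg 9 = 1 := by
  have e1 := Exec.const 9 1 (initial I)
  set σ₁ := (initial I).setReg 9 1 with hσ₁
  obtain ⟨t₂, σ₂, e2, ht₂, hI₂⟩ := exec_scan (E := I.2) (σ := σ₁) (holds_initial I) rfl rfl rfl rfl
    rfl rfl (fun _ => rfl) (fun _ => rfl)
  have f2 := e2.frame
  have ho := hI₂.odd
  have hk := hI₂.count
  have hm := hI₂.marked
  have hh := hI₂.head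
  have hn := hI₂.next
  have ht := hI₂.target
  rw [List.take_length] at hk hm
  simp only [List.take_length] at ho
  rw [hk] at hh hn ht
  have r2 : σ₂.reg 2 = 0 := f2.1 2 (by decide)
  have r9 : σ₂.reg 9 = 1 := f2.1 9 (by decide)
  obtain ⟨t₃, σ₃, e3, ht₃, hc1, hc2⟩ := exec_search hD (σ := σ₂) (f2.1 0 (by decide)) r2
    (f2.1 10 (by decide)) (f2.1 11 (by decide)) hh hn ht
    (fun v => by rw [f2.2 9 (by decide)]; rfl)
  have f3 := e3.frame
  have e4 := Exec.const 4 0 σ₃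
  set σ₄ := σ₃.setReg 4 0 with hσ₄
  have f4 := e4.frame
  have s0 : σ₄.reg 0 = I.1.length :=
    (f4.1 0 (by decide)).trans ((f3.1 0 (by decide)).trans (f2.1 0 (by decide)))
  have s2 : σ₄.reg 2 = 0 := (f4.1 2 (by decide)).trans ((f3.1 2 (by decide)).trans r2)
  have s9 : σ₄.reg 9 = 1 := (f4.1 9 (by decide)).trans ((f3.1 9 (by decide)).trans r9)
  obtain ⟨t₅, σ₅, e5, ht₅, hs, hany, hnone⟩ := exec_sum (f := markedParity I.2) (σ := σ₄) s0 s2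
    (by simp [hσ₄]) s9
    ((f4.1 17 (by decide)).trans ((f3.1 17 (by decide)).trans (f2.1 17 (by decide))))
    (by rw [f4.2 4 (by decide), f3.2 4 (by decide)]; exact ho)
    (fun v => by rw [f4.2 11 (by decide), f3.2 11 (by decide), f2.2 11 (by decide)]; rfl)
  have f5 := e5.frame
  have e6 := Exec.const 4 0 σ₅
  set σ₆ := σ₅.setReg 4 0 with hσ₆
  have f6 := e6.frame
  obtain ⟨t₇, σ₇, e7, ht₇, hcount⟩ := exec_count (σ := σ₆)
    (g := labelSum (markedParity I.2) (σ₄.arr 9) I.1.length)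
    ((f6.1 0 (by decide)).trans ((f5.1 0 (by decide)).trans s0))
    ((f6.1 2 (by decide)).trans ((f5.1 2 (by decide)).trans s2)) (by simp [hσ₆])
    ((f6.1 18 (by decide)).trans ((f5.1 18 (by decide)).trans ((f4.1 18 (by decide)).trans
      ((f3.1 18 (by decide)).trans (f2.1 18 (by decide))))))
    (by rw [f6.2 11 (by decide)]; exact hs)
  have f7 := e7.frame
  refine ⟨_, σ₇, σ₄.arr 9, e1.seq (e2.seq (e3.seq (e4.seq (e5.seq (e6.seq e7))))), ?_, ?_, ?_,
    hcount, ?_, ?_, ?_, ?_⟩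
  · have := length_darts_le I.2
    omega
  · rw [f4.2 9 (by decide)]; exact hc1
  · rw [f4.2 9 (by decide)]; exact hc2
  · rw [f7.1 17 (by decide), f6.1 17 (by decide)]; exact hany
  · rw [f7.1 17 (by decide), f6.1 17 (by decide)]; exact hnone
  · rw [f7.1 19 (by decide), f6.1 19 (by decide), f5.1 19 (by decide), f4.1 19 (by decide),
      f3.1 19 (by decide)]; exact hm
  · rw [f7.1 9 (by decide), f6.1 9 (by decide), f5.1 9 (by decide)]; exact s9

/-- Register `20` becomes `1` if the edge is not an edge of `H` and, unless `H` has no edges, has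
an end in `H`. -/
def edgeBody : Prog :=
  .seq (.load 7 3 4) (.ite 2 7 .skip (.ite 2 19
    (.seq (.load 5 1 4) (.seq (.load 8 0 5) (.seq (.ite 2 8 (.copy 20 9) .skip)
      (.seq (.load 5 2 4) (.seq (.load 8 0 5) (.ite 2 8 (.copy 20 9) .skip))))))
    (.copy 20 9)))

/-- The property of an edge that `edgeBody` tests; `B` holds the vertex bits. -/
def IsExtension (E : List (ℕ × ℕ × Bool)) (B : ℕ → ℕ) (e : ℕ × ℕ × Bool) : Prop :=
  e.2.2 = false ∧ (E.any (·.2.2) = false ∨ 0 < B e.1 ∨ 0 < B e.2.1)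

lemma exec_edge {E : List (ℕ × ℕ × Bool)} {σ : Memory} (hσ : Holds E σ) (h1 : σ.reg 1 = E.length)
    (h2 : σ.reg 2 = 0) (h4 : σ.reg 4 = 0) (h9 : σ.reg 9 = 1)
    (h19 : σ.reg 19 = (E.any (·.2.2)).toNat) (h20 : σ.reg 20 = 0) :
    ∃ t τ, Exec (.loop 4 1 (edgeBody.seq (.succ 4 4))) σ t τ ∧ t ≤ 13 * E.length + 1 ∧
      ((∃ e ∈ E, IsExtension E (σ.arr 0) e) → τ.reg 20 = 1) ∧
      ((∀ e ∈ E, ¬ IsExtension E (σ.arr 0) e) → τ.reg 20 = 0) := by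
  obtain ⟨t, τ, hex, ht, hI⟩ := exec_for (x := 4) (y := 1) (B := edgeBody) rfl (σ₀ := σ)
    (N := E.length) (by decide) (by decide)
    (fun i ρ => ((∃ e ∈ E.take i, IsExtension E (σ.arr 0) e) → ρ.reg 20 = 1) ∧
      ((∀ e ∈ E.take i, ¬ IsExtension E (σ.arr 0) e) → ρ.reg 20 = 0))
    (fun ρ hF hlt hI => by
      set i := ρ.reg 4 with hi
      have hρ2 : ρ.reg 2 = 0 := (hF.1 2 (by decide)).trans h2
      have hρ9 : ρ.reg 9 = 1 := (hF.1 9 (by decide)).trans h9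
      have hρ19 : ρ.reg 19 = (E.any (·.2.2)).toNat := (hF.1 19 (by decide)).trans h19
      have hb0 : ρ.arr 0 = σ.arr 0 := hF.2 0 (by decide)
      obtain ⟨hu, hv, hb⟩ := (hσ.congr (hF.2 1 (by decide)) (hF.2 2 (by decide))
        (hF.2 3 (by decide)) : Holds E ρ) i hlt
      have hrun : IsExtension E (σ.arr 0) E[i] → (edgeBody.run ρ).reg 20 = 1 := by
        rintro ⟨hbit, h⟩
        rw [hbit] at hb
        cases hE : E.any (·.2.2) with
        | false => simp [edgeBody, Prog.run, ← hi, hb, hρ2, hρ9, hρ19, hE]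
        | true =>
          rw [hE] at h
          by_cases h1 : 0 < σ.arr 0 E[i].2.1
          · rcases Nat.eq_zero_or_pos (σ.arr 0 E[i].1) with h2 | h2 <;>
              simp [edgeBody, Prog.run, ← hi, hb, hu, hv, hb0, hρ2, hρ9, hρ19, hE, h1, h2]
          · have h2 : 0 < σ.arr 0 E[i].1 := by simpa [h1] using h
            have h1' : σ.arr 0 E[i].2.1 = 0 := by omega
            simp [edgeBody, Prog.run, ← hi, hb, hu, hv, hb0, hρ2, hρ9, hρ19, hE, h1', h2]
      have hrun' : ¬ IsExtension E (σ.arr 0) E[i] → (edgeBody.run ρ).reg 20 = ρ.reg 20 := by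
        intro h
        unfold IsExtension at h
        cases hbit : E[i].2.2 with
        | true =>
          rw [hbit] at hb
          simp [edgeBody, Prog.run, ← hi, hb, hρ2]
        | false =>
          rw [hbit] at hb
          push Not at h
          obtain ⟨h1, h2, h3⟩ := h hbit
          have h1 : E.any (·.2.2) = true := by simpa using h1
          have h2' : σ.arr 0 E[i].1 = 0 := by omega
          have h3' : σ.arr 0 E[i].2.1 = 0 := by omega
          simp [edgeBody, Prog.run, ← hi, hb, hu, hv, hb0, hρ2, hρ19, h1, h2', h3']
      rw [take_succ_eq hlt]
      simp only [Memory.setReg_reg, List.mem_append, List.mem_singleton]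
      rw [if_neg (by decide)]
      by_cases hext : IsExtension E (σ.arr 0) E[i]
      · exact ⟨fun _ => hrun hext, fun h => absurd hext (h _ (Or.inr rfl))⟩
      · rw [hrun' hext]
        refine ⟨fun ⟨e, he, h⟩ => ?_, fun h => hI.2 fun e he => h e (Or.inl he)⟩
        rcases he with he | rfl
        · exact hI.1 ⟨e, he, h⟩
        · exact absurd h hext)
    ⟨by simp, fun _ => h20⟩ h4 h1
  rw [List.take_length] at hI
  exact ⟨t, τ, hex, ht.trans (Nat.succ_le_succ (Nat.mul_le_mul_right _ (by decide))), hI⟩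

/-- The program that decides whether `H` is S-Eulerian. -/
def circuitProg : Prog :=
  .seq countOddComponents (.ite 18 9 (.const 0 1) (.const 0 0))

/-- The program that decides whether `H` is semi S-Eulerian: if there is an odd vertex, by the test
whether the number of odd components is `0` or `2`, and otherwise by a search for a suitable edge
outside `H`. -/
def trailProg : Prog :=
  .seq countOddComponents (.seq (.const 4 0) (.seq (.loop 4 1 (edgeBody.seq (.succ 4 4)))
    (.seq (.const 21 2) (.seq (.const 22 3)
      (.ite 2 17
        (.ite 18 9 (.const 0 1) (.ite 18 21 (.const 0 0) (.ite 18 22 (.const 0 1) (.const 0 0))))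
        (.copy 0 20))))))

end Programs

/-! ### Correctness of the programs -/

section Listing

open scoped Classical

variable {n : ℕ} {G : SimpleGraph (Fin n)} {H : G.Subgraph}

lemma Listing.length_fst (L : Listing H) : L.code.1.length = n := by simp [Listing.code]

lemma Listing.adj (L : Listing H) {e : Fin n × Fin n × Bool} (he : e ∈ L.edges) :
    G.Adj e.1 e.2.1 := (L.mem_iff s(e.1, e.2.1)).1 (List.mem_map.2 ⟨e, he, rfl⟩)

lemma Listing.bit_false (L : Listing H) {e : Fin n × Fin n × Bool} (he : e ∈ L.edges) :
    e.2.2 = false ↔ s(e.1, e.2.1) ∉ H.edgeSet := by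
  rw [← L.bit_iff e he, Bool.not_eq_true]

lemma Listing.exists_edge (L : Listing H) {u v : Fin n} (h : G.Adj u v) :
    ∃ e ∈ L.edges, s(e.1, e.2.1) = s(u, v) :=
  List.mem_map.1 ((L.mem_iff s(u, v)).2 h)

lemma Listing.length_snd (L : Listing H) : L.code.2.length = G.edgeSet.ncard := by
  have h : G.edgeSet = ↑(L.edges.map fun e => s(e.1, e.2.1)).toFinset := by
    ext e
    rw [Finset.mem_coe, List.mem_toFinset, L.mem_iff]
  rw [h, Set.ncard_coe_finset, List.toFinset_card_of_nodup L.nodup]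
  simp [Listing.code]

lemma Listing.mem_darts (L : Listing H) (d : ℕ × ℕ) :
    d ∈ darts L.code.2 ↔ ∃ u v : Fin n, (rest H).Adj u v ∧ d = (↑u, ↑v) := by
  simp only [darts, Listing.code, List.mem_flatMap, List.mem_map, SimpleGraph.deleteEdges_adj]
  constructor
  · rintro ⟨_, ⟨e, he, rfl⟩, hd⟩
    cases hbit : e.2.2 with
    | true => simp [hbit] at hd
    | false =>
      have hH := (L.bit_false he).1 hbit
      simp only [hbit, Bool.false_eq_true, if_false, List.mem_cons, List.not_mem_nil,
        or_false] at hd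
      rcases hd with rfl | rfl
      · exact ⟨e.1, e.2.1, ⟨L.adj he, hH⟩, rfl⟩
      · exact ⟨e.2.1, e.1, ⟨(L.adj he).symm, by rwa [Sym2.eq_swap]⟩, rfl⟩
  · rintro ⟨u, v, ⟨hG, hH⟩, rfl⟩
    obtain ⟨e, he, heq⟩ := L.exists_edge hG
    have hbit : e.2.2 = false := (L.bit_false he).2 (by rwa [heq])
    refine ⟨_, ⟨e, he, rfl⟩, ?_⟩
    rw [Sym2.eq_iff] at heq
    rcases heq with ⟨h1, h2⟩ | ⟨h1, h2⟩ <;> simp [hbit, h1, h2]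

lemma Listing.exists_dart_iff (L : Listing H) (a b : ℕ) :
    (∃ j < (darts L.code.2).length, dartTail L.code.2 j = a ∧ dartHead L.code.2 j = b) ↔
      ∃ u v : Fin n, (rest H).Adj u v ∧ a = u ∧ b = v := by
  have h1 : (∃ j < (darts L.code.2).length, dartTail L.code.2 j = a ∧ dartHead L.code.2 j = b) ↔
      (a, b) ∈ darts L.code.2 := by
    rw [List.mem_iff_getElem]
    refine exists_congr fun j => ?_
    rw [← exists_prop]
    refine ⟨fun ⟨hj, h⟩ => ⟨hj, ?_⟩, fun ⟨hj, h⟩ => ⟨hj, ?_⟩⟩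
    · simpa [dartTail, dartHead, hj, Prod.ext_iff] using h
    · simp [dartTail, dartHead, hj, h]
  rw [h1, L.mem_darts]
  simp

lemma Listing.dartSystem (L : Listing H) : DartSystem n (darts L.code.2).length
    (dartTail L.code.2) (dartHead L.code.2) := by
  have key : ∀ j < (darts L.code.2).length, ∃ u v : Fin n, (rest H).Adj u v ∧
      dartTail L.code.2 j = u ∧ dartHead L.code.2 j = v := fun j hj =>
    (L.exists_dart_iff _ _).1 ⟨j, hj, rfl, rfl⟩
  refine ⟨fun j hj => ?_, fun j hj => ?_, fun j hj => ?_⟩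
  · obtain ⟨u, v, -, h, -⟩ := key j hj
    rw [h]; exact u.2
  · obtain ⟨u, v, -, -, h⟩ := key j hj
    rw [h]; exact v.2
  · obtain ⟨u, v, huv, h1, h2⟩ := key j hj
    exact (L.exists_dart_iff _ _).2 ⟨v, u, huv.symm, h2, h1⟩

lemma Listing.linked_iff (L : Listing H) (u v : Fin n) :
    Linked (darts L.code.2).length (dartTail L.code.2) (dartHead L.code.2) u v ↔
      (rest H).Reachable u v := by
  rw [SimpleGraph.reachable_iff_reflTransGen]
  constructor
  · intro h
    suffices key : ∀ b, Linked (darts L.code.2).length (dartTail L.code.2) (dartHead L.code.2) u b →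
        ∃ w : Fin n, b = w ∧ Relation.ReflTransGen (rest H).Adj u w by
      obtain ⟨w, hw, hr⟩ := key _ h
      rwa [Fin.ext hw]
    intro b hb
    induction hb with
    | refl => exact ⟨u, rfl, .refl⟩
    | tail _ hbc ih =>
      obtain ⟨w, rfl, hr⟩ := ih
      obtain ⟨x, y, hxy, hwx, rfl⟩ := (L.exists_dart_iff _ _).1 hbc
      rw [Fin.ext hwx] at hr
      exact ⟨y, rfl, hr.tail hxy⟩
  · intro h
    induction h with
    | refl => exact .refl
    | tail _ hbc ih => exact ih.tail ((L.exists_dart_iff _ _).2 ⟨_, _, hbc, rfl, rfl⟩)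

lemma Listing.markedParity_eq (L : Listing H) (v : Fin n) :
    markedParity L.code.2 v = ind (oddVerts H) v := by
  rw [← parity_edgeSet]
  set g : Sym2 (Fin n) → ZMod 2 := fun e =>
    if e ∈ H.edgeSet then parity {e} v else 0 with hg
  have h1 : markedParity L.code.2 v = ((L.edges.map fun e => s(e.1, e.2.1)).map g).sum := by
    rw [markedParity, Listing.code, List.map_map, List.map_map]
    refine congrArg List.sum (List.map_congr_left fun e he => ?_)
    simp only [Function.comp_apply, hg]
    rw [parity_edge (L.adj he).ne]
    refine if_congr (L.bit_iff e he) ?_ rfl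
    simp only [delta, Fin.ext_iff]
  rw [h1, ← List.sum_toFinset g L.nodup, hg, parity_eq_sum, ← Finset.sum_filter]
  refine Finset.sum_congr ?_ fun _ _ => rfl
  ext e
  rw [Finset.mem_filter, List.mem_toFinset, L.mem_iff, Set.mem_toFinset]
  exact ⟨fun h => h.2, fun h => ⟨H.edgeSet_subset h, h⟩⟩

lemma Listing.any_eq_false (L : Listing H) :
    L.code.2.any (·.2.2) = false ↔ H.edgeSet = ∅ := by
  rw [List.any_eq_false, Set.eq_empty_iff_forall_notMem]
  simp only [Listing.code, List.mem_map, forall_exists_index, and_imp,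
    forall_apply_eq_imp_iff₂, Bool.not_eq_true]
  constructor
  · intro h e he
    induction e with | _ u v =>
    obtain ⟨e', he', heq⟩ := L.exists_edge (H.edgeSet_subset he)
    exact (L.bit_false he').1 (h e' he') (by rwa [heq])
  · intro h e he
    exact (L.bit_false he).2 (h _)

lemma Listing.vertex_bit (L : Listing H) (v : Fin n) :
    0 < (initial L.code).arr 0 v ↔ v ∈ H.verts := by
  by_cases hv : v ∈ H.verts <;> simp [initial, Listing.code, hv]

lemma Listing.exists_extension_iff (L : Listing H) :
    (∃ e ∈ L.code.2, IsExtension L.code.2 ((initial L.code).arr 0) e) ↔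
      ∃ e ∈ G.edgeSet, e ∉ H.edgeSet ∧ (H.edgeSet = ∅ ∨ ∃ v ∈ H.verts, v ∈ e) := by
  have key : ∀ e ∈ L.edges, IsExtension L.code.2 ((initial L.code).arr 0) (↑e.1, ↑e.2.1, e.2.2) ↔
      s(e.1, e.2.1) ∉ H.edgeSet ∧ (H.edgeSet = ∅ ∨ ∃ v ∈ H.verts, v ∈ s(e.1, e.2.1)) := by
    intro e he
    unfold IsExtension
    rw [L.bit_false he, L.any_eq_false, L.vertex_bit, L.vertex_bit]
    refine and_congr_right fun _ => or_congr_right ?_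
    simp only [Sym2.mem_iff]
    constructor
    · rintro (h | h)
      · exact ⟨_, h, Or.inl rfl⟩
      · exact ⟨_, h, Or.inr rfl⟩
    · rintro ⟨v, hv, rfl | rfl⟩
      · exact Or.inl hv
      · exact Or.inr hv
  constructor
  · rintro ⟨e', he', h⟩
    obtain ⟨e, he, rfl⟩ := List.mem_map.1 he'
    exact ⟨s(e.1, e.2.1), L.adj he, (key e he).1 h⟩
  · rintro ⟨e', he', h⟩
    induction e' with | _ u v =>
    obtain ⟨e, he, heq⟩ := L.exists_edge he'
    rw [← heq] at h
    exact ⟨_, List.mem_map.2 ⟨e, he, rfl⟩, (key e he).2 h⟩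

end Listing

section OddLabels

open scoped Classical

variable {n : ℕ} {K : SimpleGraph (Fin n)} {c : ℕ → ℕ} {g : ℕ → ZMod 2} {f : Fin n → ZMod 2}

lemma labelSum_eq (hg : ∀ v : Fin n, g v = f v) (l : ℕ) :
    labelSum g c n l = ∑ v : Fin n, if c v = l then f v else 0 := by
  rw [labelSum, Finset.sum_range]
  simp only [hg]

lemma labelSum_eq_comp (hg : ∀ v : Fin n, g v = f v)
    (hc : ∀ u v : Fin n, c u = c v ↔ K.Reachable u v) (v : Fin n) :
    labelSum g c n (c v) = ∑ x ∈ comp K v, f x := by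
  rw [labelSum_eq hg, ← Finset.sum_filter]
  refine Finset.sum_congr ?_ fun _ _ => rfl
  ext x
  rw [Finset.mem_filter, mem_comp, eq_comm, hc]
  exact and_iff_right (Finset.mem_univ x)

/-- A label that does not occur has an empty sum, so `oddLabels` corresponds to the components of
odd sum. -/
lemma mem_oddLabels (hg : ∀ v : Fin n, g v = f v)
    (hc : ∀ u v : Fin n, c u = c v ↔ K.Reachable u v) (hn : ∀ v : Fin n, 1 ≤ c v ∧ c v ≤ n)
    {l : ℕ} : l ∈ oddLabels g c n ↔ ∃ v : Fin n, c v = l + 1 ∧ ∑ x ∈ comp K v, f x ≠ 0 := by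
  rw [oddLabels, Finset.mem_filter, Finset.mem_range]
  constructor
  · rintro ⟨-, h⟩
    have h' := h
    rw [labelSum_eq hg] at h'
    obtain ⟨v, -, hv⟩ := Finset.exists_ne_zero_of_sum_ne_zero h'
    have hcv : c v = l + 1 := by
      by_contra hne
      exact hv (if_neg hne)
    exact ⟨v, hcv, by rwa [← labelSum_eq_comp hg hc, hcv]⟩
  · rintro ⟨v, hcv, h⟩
    have := (hn v).2
    exact ⟨by omega, by rwa [← hcv, labelSum_eq_comp hg hc]⟩

lemma oddLabels_eq_empty_iff (hg : ∀ v : Fin n, g v = f v)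
    (hc : ∀ u v : Fin n, c u = c v ↔ K.Reachable u v) (hn : ∀ v : Fin n, 1 ≤ c v ∧ c v ≤ n) :
    oddLabels g c n = ∅ ↔ Balanced K f := by
  rw [Finset.eq_empty_iff_forall_notMem]
  simp only [mem_oddLabels hg hc hn]
  constructor
  · intro h v
    by_contra hv
    have := (hn v).1
    exact h (c v - 1) ⟨v, by omega, hv⟩
  · rintro h l ⟨v, -, hv⟩
    exact hv (h v)

lemma sum_comp_delta_label (hc : ∀ u v : Fin n, c u = c v ↔ K.Reachable u v) (a v : Fin n) :
    ∑ x ∈ comp K v, delta a x = if c v = c a then 1 else 0 := by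
  rw [sum_comp_delta]
  by_cases h : K.Reachable v a
  · rw [if_pos h, if_pos ((hc v a).2 h)]
  · rw [if_neg h, if_neg fun h' => h ((hc v a).1 h')]

/-- For a nonempty set `T`, the number of components that meet `T` in an odd number of vertices is
`0` or `2` iff two vertices can be removed from `T` so that all these numbers become even. -/
lemma card_oddLabels_iff {T : Set (Fin n)} (hT : T.Nonempty) (hg : ∀ v : Fin n, g v = ind T v)
    (hc : ∀ u v : Fin n, c u = c v ↔ K.Reachable u v) (hn : ∀ v : Fin n, 1 ≤ c v ∧ c v ≤ n) :
    ((oddLabels g c n).card = 0 ∨ (oddLabels g c n).card = 2) ↔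
      ∃ a b, a ≠ b ∧ a ∈ T ∧ b ∈ T ∧ Balanced K (ind (T \ {a, b})) := by
  constructor
  · rintro (h | h)
    · rw [Finset.card_eq_zero, oddLabels_eq_empty_iff hg hc hn] at h
      obtain ⟨a, ha⟩ := hT
      obtain ⟨b, hba, hab, hb⟩ := exists_second (h a) (ind_ne_zero.2 ha)
      refine ⟨a, b, hba.symm, ha, ind_ne_zero.1 hb, ?_⟩
      rw [ind_diff_pair ha (ind_ne_zero.1 hb) hba.symm]
      exact h.add (balanced_delta hab)
    · obtain ⟨l, m, hlm, hS⟩ := Finset.card_eq_two.1 h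
      have key : ∀ l, l ∈ oddLabels g c n → ∃ a ∈ T, c a = l + 1 := by
        intro l hl
        obtain ⟨v, hv, hsum⟩ := (mem_oddLabels hg hc hn).1 hl
        obtain ⟨a, ha, hne⟩ := Finset.exists_ne_zero_of_sum_ne_zero hsum
        exact ⟨a, ind_ne_zero.1 hne, by rw [← hv]; exact ((hc v a).2 (mem_comp.1 ha)).symm⟩
      obtain ⟨a, ha, hal⟩ := key l (by simp [hS])
      obtain ⟨b, hb, hbm⟩ := key m (by simp [hS])
      have hab : a ≠ b := by rintro rfl; omega
      refine ⟨a, b, hab, ha, hb, ?_⟩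
      rw [ind_diff_pair ha hb hab]
      intro v
      have hmem : c v - 1 ∈ oddLabels g c n ↔ ∑ x ∈ comp K v, ind T x ≠ 0 := by
        have hv1 := (hn v).1
        have hvn := (hn v).2
        rw [oddLabels, Finset.mem_filter, Finset.mem_range, Nat.sub_add_cancel hv1,
          labelSum_eq_comp hg hc]
        exact and_iff_right (by omega)
      rw [hS, Finset.mem_insert, Finset.mem_singleton] at hmem
      rw [Finset.sum_add_distrib, Finset.sum_add_distrib, sum_comp_delta_label hc, sum_comp_delta_label hc]
      have hv1 := (hn v).1
      by_cases h1 : c v = c a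
      · rw [zmod_two_eq_one (hmem.1 (by omega)), if_pos h1, if_neg (by omega)]
        rfl
      · by_cases h2 : c v = c b
        · rw [zmod_two_eq_one (hmem.1 (by omega)), if_pos h2, if_neg (by omega)]
          rfl
        · rw [if_neg h1, if_neg h2]
          have : ∑ x ∈ comp K v, ind T x = 0 := by
            by_contra h0
            have := hmem.2 h0
            omega
          rw [this]
          rfl
  · rintro ⟨a, b, hab, ha, hb, h⟩
    rw [ind_diff_pair ha hb hab] at h
    have hsum : ∀ v, ∑ x ∈ comp K v, ind T x =
        (if c v = c a then 1 else 0) + (if c v = c b then 1 else 0) := by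
      intro v
      have h' := h v
      rw [Finset.sum_add_distrib, Finset.sum_add_distrib, sum_comp_delta_label hc,
        sum_comp_delta_label hc] at h'
      exact CharTwo.add_eq_zero.1 h'
    by_cases hcab : c a = c b
    · left
      rw [Finset.card_eq_zero, oddLabels_eq_empty_iff hg hc hn]
      intro v
      rw [hsum, hcab]
      exact CharTwo.add_self_eq_zero _
    · right
      have ha1 := (hn a).1
      have hb1 := (hn b).1
      refine Finset.card_eq_two.2 ⟨c a - 1, c b - 1, by omega, ?_⟩
      ext l
      rw [mem_oddLabels hg hc hn, Finset.mem_insert, Finset.mem_singleton]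
      constructor
      · rintro ⟨v, hv, hne⟩
        rw [hsum] at hne
        by_contra hcon
        exact hne (by rw [if_neg (by omega), if_neg (by omega)]; rfl)
      · rintro (rfl | rfl)
        · refine ⟨a, by omega, ?_⟩
          rw [hsum, if_pos rfl, if_neg hcab]
          decide
        · refine ⟨b, by omega, ?_⟩
          rw [hsum, if_pos rfl, if_neg (Ne.symm hcab)]
          decide

end OddLabels

section Decision

variable {n : ℕ} {G : SimpleGraph (Fin n)} {H : G.Subgraph}

lemma Listing.exec_countOddComponents (L : Listing H) :
    ∃ t τ c, Exec countOddComponents (initial L.code) t τ ∧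
      t ≤ 51 * G.edgeSet.ncard + 67 * n + 7 ∧
      (∀ v : Fin n, 1 ≤ c v ∧ c v ≤ n) ∧
      (∀ u v : Fin n, c u = c v ↔ (rest H).Reachable u v) ∧
      τ.reg 18 = (oddLabels (markedParity L.code.2) c n).card ∧
      ((oddVerts H).Nonempty → τ.reg 17 = 1) ∧ (oddVerts H = ∅ → τ.reg 17 = 0) ∧
      τ.reg 19 = (L.code.2.any (·.2.2)).toNat ∧ τ.reg 9 = 1 := by
  obtain ⟨t, τ, c, hex, ht, h1, h2, h3, h4, h5, h6, h7⟩ :=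
    SEulerian.exec_countOddComponents L.code (by rw [L.length_fst]; exact L.dartSystem)
  rw [L.length_fst, L.length_snd] at ht
  rw [L.length_fst] at h1 h2 h3 h4 h5
  refine ⟨t, τ, c, hex, ht, fun v => h1 v v.2, fun u v => ?_, h3, fun ⟨v, hv⟩ => ?_, fun h => ?_,
    h6, h7⟩
  · rw [h2 u u.2 v v.2, L.linked_iff]
  · exact h4 ⟨v, v.2, by rw [L.markedParity_eq]; exact ind_ne_zero.2 hv⟩
  · refine h5 fun v hv => ?_
    have := L.markedParity_eq ⟨v, hv⟩
    rw [h] at this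
    simpa [ind] using this

theorem isSEulerian_decidable : DecidableInLinearTime (fun H => IsSEulerian H) := by
  refine ⟨circuitProg, 200, fun n G H hH L => ?_⟩
  obtain ⟨t, τ, c, hex, ht, hn, hc, h18, -, -, -, h9⟩ := L.exec_countOddComponents
  have hpos : 0 < n := (hH.nonempty.some).pos
  have hiff : IsSEulerian H ↔ τ.reg 18 = 0 := by
    rw [isSEulerian_iff_balanced hH, h18, Finset.card_eq_zero,
      oddLabels_eq_empty_iff L.markedParity_eq hc hn]
  obtain ⟨s, hs, hex'⟩ := exec_run (.ite 18 9 (.const 0 1) (.const 0 0)) rfl τ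
  refine ⟨_, _, hex.seq hex', ?_, fun h => ?_, fun h => ?_⟩
  · have : s ≤ 2 := hs
    omega
  · simp [Prog.run, h9, hiff.1 h]
  · have : ¬ τ.reg 18 < 1 := fun h' => h (hiff.2 (by omega))
    simp [Prog.run, h9, this]

theorem isSemiSEulerian_decidable : DecidableInLinearTime (fun H => IsSemiSEulerian H) := by
  refine ⟨trailProg, 200, fun n G H hH L => ?_⟩
  obtain ⟨t, τ, c, hex, ht, hn, hc, h18, hne, hem, h19, h9⟩ := L.exec_countOddComponents
  have hpos : 0 < n := (hH.nonempty.some).pos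
  have fr := hex.frame
  have e2 := Exec.const 4 0 τ
  set τ₂ := τ.setReg 4 0 with hτ₂
  obtain ⟨t₃, τ₃, e3, ht₃, hyes, hno⟩ := exec_edge (E := L.code.2) (σ := τ₂)
    ((holds_initial L.code).congr (fr.2 1 (by decide)) (fr.2 2 (by decide)) (fr.2 3 (by decide)))
    (by simp [hτ₂, fr.1 1 (by decide)]; rfl) (by simp [hτ₂, fr.1 2 (by decide)]; rfl)
    (by simp [hτ₂]) (by simp [hτ₂, h9]) (by simp [hτ₂, h19])
    (by simp [hτ₂, fr.1 20 (by decide)]; rfl)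
  have f3 := e3.frame
  rw [show τ₂.arr 0 = (initial L.code).arr 0 from fr.2 0 (by decide)] at hyes hno
  have g18 : τ₃.reg 18 = τ.reg 18 := by rw [f3.1 18 (by decide)]; simp [hτ₂]
  have g17 : τ₃.reg 17 = τ.reg 17 := by rw [f3.1 17 (by decide)]; simp [hτ₂]
  have g9 : τ₃.reg 9 = 1 := by rw [f3.1 9 (by decide)]; simp [hτ₂, h9]
  have g2 : τ₃.reg 2 = 0 := by
    rw [f3.1 2 (by decide)]; simp [hτ₂, fr.1 2 (by decide)]; rfl
  set Q : Prog := .seq (.const 21 2) (.seq (.const 22 3)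
      (.ite 2 17
        (.ite 18 9 (.const 0 1) (.ite 18 21 (.const 0 0) (.ite 18 22 (.const 0 1) (.const 0 0))))
        (.copy 0 20))) with hQ
  obtain ⟨s, hs, hex'⟩ := exec_run Q rfl τ₃
  refine ⟨_, _, hex.seq (e2.seq (e3.seq hex')), ?_, ?_⟩
  · have : s ≤ 7 := hs
    rw [L.length_snd] at ht₃
    omega
  beta_reduce
  rcases (oddVerts H).eq_empty_or_nonempty with hT | hT
  · have hrun : (Q.run τ₃).reg 0 = τ₃.reg 20 := by
      simp [hQ, Prog.run, g2, g17, hem hT]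
    rw [hrun]
    rw [isSemiSEulerian_iff_exists_edge hH hT, ← L.exists_extension_iff]
    exact ⟨hyes, fun h => hno fun e he h' => h ⟨e, he, h'⟩⟩
  · rw [isSemiSEulerian_iff_balanced hH hT, ← card_oddLabels_iff hT L.markedParity_eq hc hn, ← h18]
    constructor
    · rintro (h | h) <;> simp [hQ, Prog.run, g2, g9, g17, g18, hne hT, h]
    · intro h
      rcases Nat.lt_trichotomy (τ.reg 18) 1 with h1 | h1 | h1
      · omega
      · simp [hQ, Prog.run, g2, g9, g17, g18, hne hT, h1]
      · have h2 : ¬ τ.reg 18 = 0 := by omega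
        have h3 : ¬ τ.reg 18 < 2 := by omega
        have h4 : ¬ τ.reg 18 < 3 := by omega
        simp [hQ, Prog.run, g2, g9, g17, g18, hne hT, h2, h3, h4]

end Decision

/-! ### Computing the trails -/

section Search

open scoped Classical

/-- The pairs of consecutive entries of a list. -/
def steps (l : List ℕ) : List (ℕ × ℕ) :=
  (List.range (l.length - 1)).map fun i => (l.getD i 0, l.getD (i + 1) 0)

/-- The pair `d` consists of the ends of the listed edge `e`. -/
def Joins (e : ℕ × ℕ × Bool) (d : ℕ × ℕ) : Prop :=
  (e.1 = d.1 ∧ e.2.1 = d.2) ∨ (e.1 = d.2 ∧ e.2.1 = d.1)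

/-- The number of times that the vertex sequence `l` runs through the edge `e`. -/
noncomputable def uses (e : ℕ × ℕ × Bool) (l : List ℕ) : ℕ :=
  ((steps l).filter fun d => Joins e d).length

/-- The vertex sequence `l` is that of a trail of `G` through all edges of `H`. -/
def IsTrailList (I : Code) (l : List ℕ) : Prop :=
  (∀ d ∈ steps l, ∃ e ∈ I.2, Joins e d) ∧
    ∀ e ∈ I.2, uses e l ≤ 1 ∧ (e.2.2 = true → 1 ≤ uses e l)

/-- All lists of length `k` with entries less than `n`. -/
def listsOfLength (n k : ℕ) : List (List ℕ) :=
  Nat.rec [[]] (fun _ L => L.flatMap fun l => (List.range n).map fun x => x :: l) k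

/-- The vertex sequences that may belong to trails. -/
def candidates (I : Code) : List (List ℕ) :=
  (List.range (I.2.length + 1)).flatMap fun k => listsOfLength I.1.length (k + 1)

/-- Exhaustive search for the vertex sequence of a trail of `G` through all edges of `H`, which is
closed or open according to `closed`. -/
noncomputable def findTrail (closed : Bool) (I : Code) : Option (List ℕ) :=
  ((candidates I).filterMap fun l =>
    if IsTrailList I l ∧ decide (l.head? = l.reverse.head?) = closed then some l else none).head?

lemma primrec_steps : Primrec steps := by
  refine Primrec.list_map (Primrec.list_range.comp
    (Primrec.nat_sub.comp Primrec.list_length (.const 1))) ?_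
  exact (Primrec.pair ((Primrec.list_getD 0).comp .fst .snd)
    ((Primrec.list_getD 0).comp .fst (Primrec.succ.comp .snd)) :)

lemma primrecRel_joins : PrimrecRel Joins := by
  have h : ∀ {f g : (ℕ × ℕ × Bool) × (ℕ × ℕ) → ℕ}, Primrec f → Primrec g →
      PrimrecPred fun x => f x = g x := fun hf hg => Primrec.eq.comp hf hg
  have e1 : Primrec fun x : (ℕ × ℕ × Bool) × (ℕ × ℕ) => x.1.1 := Primrec.fst.comp .fst
  have e2 : Primrec fun x : (ℕ × ℕ × Bool) × (ℕ × ℕ) => x.1.2.1 :=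
    Primrec.fst.comp (Primrec.snd.comp .fst)
  have d1 : Primrec fun x : (ℕ × ℕ × Bool) × (ℕ × ℕ) => x.2.1 := Primrec.fst.comp .snd
  have d2 : Primrec fun x : (ℕ × ℕ × Bool) × (ℕ × ℕ) => x.2.2 := Primrec.snd.comp .snd
  exact ((h e1 d1).and (h e2 d2)).or ((h e1 d2).and (h e2 d1))

lemma primrec_uses : Primrec₂ uses := by
  have h := (PrimrecRel.listFilter (R := fun d e => Joins e d)
    (primrecRel_joins.comp₂ Primrec₂.right Primrec₂.left))
  exact Primrec.list_length.comp (h.comp (primrec_steps.comp .snd) .fst)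

lemma primrecRel_isTrailList : PrimrecRel IsTrailList := by
  have h1 : PrimrecRel fun (ds : List (ℕ × ℕ)) (E : List (ℕ × ℕ × Bool)) =>
      ∀ d ∈ ds, ∃ e ∈ E, Joins e d := by
    refine PrimrecRel.forall_mem_list (R := fun d (E : List (ℕ × ℕ × Bool)) => ∃ e ∈ E, Joins e d) ?_
    exact (PrimrecRel.exists_mem_list primrecRel_joins).comp₂ Primrec₂.right Primrec₂.left
  have h2 : PrimrecRel fun (e : ℕ × ℕ × Bool) (l : List ℕ) =>
      uses e l ≤ 1 ∧ (e.2.2 = true → 1 ≤ uses e l) := by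
    have hu : Primrec fun x : (ℕ × ℕ × Bool) × List ℕ => uses x.1 x.2 := primrec_uses
    have hb : PrimrecPred fun x : (ℕ × ℕ × Bool) × List ℕ => x.1.2.2 = true :=
      Primrec.eq.comp (Primrec.snd.comp (Primrec.snd.comp .fst)) (.const true)
    refine PrimrecPred.and (Primrec.nat_le.comp hu (.const 1)) ?_
    refine (hb.not.or (Primrec.nat_le.comp (.const 1) hu)).of_eq fun x => ?_
    exact imp_iff_not_or.symm
  have h3 := PrimrecRel.forall_mem_list h2
  exact PrimrecPred.and
    (h1.comp (primrec_steps.comp .snd) (Primrec.snd.comp .fst))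
    (h3.comp (Primrec.snd.comp .fst) .snd)

lemma primrec_listsOfLength : Primrec₂ listsOfLength := by
  refine Primrec.nat_rec (f := fun _ : ℕ => [[]])
    (g := fun (n : ℕ) (x : ℕ × List (List ℕ)) =>
      x.2.flatMap fun l => (List.range n).map fun y => y :: l) (.const _) ?_
  refine Primrec.list_flatMap (Primrec.snd.comp .snd) ?_
  refine Primrec.list_map (Primrec.list_range.comp (Primrec.fst.comp .fst)) ?_
  exact Primrec.list_cons.comp .snd (Primrec.snd.comp .fst)

lemma primrec_candidates : Primrec candidates := by
  refine Primrec.list_flatMap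
    (Primrec.list_range.comp (Primrec.succ.comp (Primrec.list_length.comp .snd))) ?_
  exact primrec_listsOfLength.comp (Primrec.list_length.comp (Primrec.fst.comp .fst))
    (Primrec.succ.comp .snd)

lemma computable_findTrail (closed : Bool) : Computable (findTrail closed) := by
  refine Primrec.to_comp ?_
  refine Primrec.list_head?.comp (Primrec.listFilterMap primrec_candidates ?_)
  have hends : PrimrecPred fun x : Code × List ℕ => x.2.head? = x.2.reverse.head? :=
    Primrec.eq.comp (Primrec.list_head?.comp .snd)
      (Primrec.list_head?.comp (Primrec.list_reverse.comp .snd))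
  refine Primrec.ite (PrimrecPred.and primrecRel_isTrailList ?_)
    (Primrec.option_some.comp .snd) (.const none)
  exact Primrec.eq.comp hends.decide (.const closed)

lemma mem_listsOfLength {n k : ℕ} {l : List ℕ} :
    l ∈ listsOfLength n k ↔ l.length = k ∧ ∀ x ∈ l, x < n := by
  induction k generalizing l with
  | zero =>
    have : listsOfLength n 0 = [[]] := rfl
    simp only [this, List.mem_singleton, List.length_eq_zero_iff]
    exact ⟨fun h => ⟨h, by simp [h]⟩, fun h => h.1⟩
  | succ k ih =>
    have : listsOfLength n (k + 1) =
      (listsOfLength n k).flatMap fun l => (List.range n).map fun x => x :: l := rfl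
    simp only [this, List.mem_flatMap, List.mem_map, List.mem_range, ih]
    constructor
    · rintro ⟨l, ⟨rfl, hl⟩, x, hx, rfl⟩
      exact ⟨rfl, by simpa using ⟨hx, hl⟩⟩
    · rintro ⟨hl, h⟩
      obtain ⟨x, l, rfl⟩ := List.exists_cons_of_length_eq_add_one hl
      exact ⟨l, ⟨by simpa using hl, fun y hy => h y (by simp [hy])⟩, x, h x (by simp), rfl⟩

lemma steps_cons_cons (a b : ℕ) (l : List ℕ) : steps (a :: b :: l) = (a, b) :: steps (b :: l) := by
  simp [steps, List.range_succ_eq_map]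

variable {n : ℕ} {G : SimpleGraph (Fin n)} {H : G.Subgraph}

lemma steps_support {u v : Fin n} (p : G.Walk u v) :
    steps (p.support.map Fin.val) = p.darts.map fun d => ((d.fst : ℕ), (d.snd : ℕ)) := by
  induction p with
  | nil => simp [steps]
  | cons h p ih =>
    rw [SimpleGraph.Walk.support_cons, SimpleGraph.Walk.darts_cons, List.map_cons, List.map_cons,
      ← ih, ← p.cons_tail_support, List.map_cons, steps_cons_cons]

lemma exists_walk_of_steps (l : List (Fin n)) (a : Fin n)
    (h : ∀ u v : Fin n, ((u : ℕ), (v : ℕ)) ∈ steps ((a :: l).map Fin.val) → G.Adj u v) :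
    ∃ (v : Fin n) (p : G.Walk a v), p.support = a :: l := by
  induction l generalizing a with
  | nil => exact ⟨a, .nil, rfl⟩
  | cons b l ih =>
    simp only [List.map_cons, steps_cons_cons] at h ih
    obtain ⟨v, p, hp⟩ := ih b fun u v huv => h u v (List.mem_cons_of_mem _ huv)
    exact ⟨v, .cons (h a b List.mem_cons_self) p, by rw [SimpleGraph.Walk.support_cons, hp]⟩

lemma joins_iff (e : Fin n × Fin n × Bool) (u v : Fin n) :
    Joins (↑e.1, ↑e.2.1, e.2.2) (↑u, ↑v) ↔ s(e.1, e.2.1) = s(u, v) := by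
  simp only [Joins, Sym2.eq_iff, Fin.ext_iff]

lemma uses_support {u v : Fin n} (p : G.Walk u v) (e : Fin n × Fin n × Bool) :
    uses (↑e.1, ↑e.2.1, e.2.2) (p.support.map Fin.val) = p.edges.count s(e.1, e.2.1) := by
  rw [uses, steps_support, List.filter_map, List.length_map, SimpleGraph.Walk.edges,
    List.count, List.countP_map, List.countP_eq_length_filter]
  congr 1
  refine List.filter_congr fun d _ => ?_
  simp only [Function.comp_apply, joins_iff]
  rw [Bool.eq_iff_iff, decide_eq_true_iff, beq_iff_eq, eq_comm]
  rfl

lemma Listing.isTrailList_support (L : Listing H) {u v : Fin n} (p : G.Walk u v) :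
    IsTrailList L.code (p.support.map Fin.val) ↔ p.IsTrail ∧ ∀ e ∈ H.edgeSet, e ∈ p.edges := by
  have hmem : ∀ e, e ∈ L.code.2 ↔ ∃ e' ∈ L.edges, (↑e'.1, ↑e'.2.1, e'.2.2) = e := fun e =>
    List.mem_map
  constructor
  · rintro ⟨-, h⟩
    have h' : ∀ e ∈ L.edges, p.edges.count s(e.1, e.2.1) ≤ 1 ∧
        (e.2.2 = true → 1 ≤ p.edges.count s(e.1, e.2.1)) := fun e he => by
      have := h _ ((hmem _).2 ⟨e, he, rfl⟩)
      rwa [uses_support] at this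
    constructor
    · rw [SimpleGraph.Walk.isTrail_def, List.nodup_iff_count_le_one]
      intro e
      by_cases he : e ∈ p.edges
      · induction e with | _ a b =>
        obtain ⟨e', he', heq⟩ := L.exists_edge (p.edges_subset_edgeSet he)
        rw [← heq]
        exact (h' e' he').1
      · rw [List.count_eq_zero_of_not_mem he]
        exact Nat.zero_le _
    · intro e he
      induction e with | _ a b =>
      obtain ⟨e', he', heq⟩ := L.exists_edge (H.edgeSet_subset he)
      rw [← heq] at he ⊢
      exact List.count_pos_iff.1 ((h' e' he').2 ((L.bit_iff e' he').2 he))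
  · rintro ⟨hp, hH⟩
    constructor
    · intro d hd
      rw [steps_support] at hd
      obtain ⟨d, hd, rfl⟩ := List.mem_map.1 hd
      obtain ⟨e, he, heq⟩ := L.exists_edge d.adj
      exact ⟨_, (hmem _).2 ⟨e, he, rfl⟩, (joins_iff _ _ _).2 heq⟩
    · intro e' he'
      obtain ⟨e, he, rfl⟩ := (hmem _).1 he'
      rw [uses_support]
      refine ⟨List.nodup_iff_count_le_one.1 hp.edges_nodup _, fun hbit => ?_⟩
      exact List.count_pos_iff.2 (hH _ ((L.bit_iff e he).1 hbit))

lemma Listing.exists_walk (L : Listing H) {l : List ℕ} (hl : l ∈ candidates L.code)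
    (h : IsTrailList L.code l) : ∃ (u v : Fin n) (p : G.Walk u v), p.support.map Fin.val = l := by
  simp only [candidates, List.mem_flatMap, mem_listsOfLength, L.length_fst] at hl
  obtain ⟨k, -, hlen, hlt⟩ := hl
  obtain ⟨l, rfl⟩ : ∃ l' : List (Fin n), l'.map Fin.val = l :=
    ⟨l.attach.map fun x => ⟨x.1, hlt _ x.2⟩, by simp [List.map_map, Function.comp_def]⟩
  obtain ⟨a, l, rfl⟩ := List.exists_cons_of_length_eq_add_one ((List.length_map _).symm.trans hlen)
  obtain ⟨v, p, hp⟩ := exists_walk_of_steps (G := G) l a fun u v huv => by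
    obtain ⟨e', he', hj⟩ := h.1 _ huv
    obtain ⟨e, he, rfl⟩ := List.mem_map.1 he'
    have := L.adj he
    rwa [← SimpleGraph.mem_edgeSet, (joins_iff e u v).1 hj] at this
  exact ⟨a, v, p, by rw [hp]⟩

lemma Listing.mem_candidates (L : Listing H) {u v : Fin n} {p : G.Walk u v} (hp : p.IsTrail) :
    p.support.map Fin.val ∈ candidates L.code := by
  simp only [candidates, List.mem_flatMap, mem_listsOfLength, L.length_fst, List.mem_range]
  refine ⟨p.length, ?_, by simp, fun x hx => ?_⟩
  · rw [L.length_snd, ← p.length_edges, ← List.toFinset_card_of_nodup hp.edges_nodup,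
      ← Set.ncard_coe_finset]
    refine Nat.lt_succ_of_le (Set.ncard_le_ncard (fun e he => ?_) (Set.toFinite _))
    exact p.edges_subset_edgeSet (by simpa using he)
  · obtain ⟨y, -, rfl⟩ := List.mem_map.1 hx
    exact y.2

lemma head?_support {u v : Fin n} (p : G.Walk u v) :
    (p.support.map Fin.val).head? = (p.support.map Fin.val).reverse.head? ↔ u = v := by
  have h : ∀ {a b : Fin n} (q : G.Walk a b), (q.support.map Fin.val).head? = some (a : ℕ) :=
    fun q => by cases q <;> rfl
  rw [← List.map_reverse, ← SimpleGraph.Walk.support_reverse, h, h, Option.some_inj, Fin.ext_iff]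

/-- Exhaustive search finds a trail through all edges of `H`, closed or open as wanted, if there
is one. -/
lemma Listing.findTrail_spec (L : Listing H) (closed : Bool) :
    (∃ (u v : Fin n) (p : G.Walk u v), decide (u = v) = closed ∧ (p.IsTrail ∧
      ∀ e ∈ H.edgeSet, e ∈ p.edges) ∧ findTrail closed L.code = some (p.support.map Fin.val)) ∨
    (∀ (u v : Fin n) (p : G.Walk u v), decide (u = v) = closed →
      ¬ (p.IsTrail ∧ ∀ e ∈ H.edgeSet, e ∈ p.edges)) ∧ findTrail closed L.code = none := by
  cases hf : findTrail closed L.code with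
  | none =>
    refine Or.inr ⟨fun u v p huv hp => ?_, rfl⟩
    rw [findTrail, List.head?_eq_none_iff, List.filterMap_eq_nil_iff] at hf
    have := hf _ (L.mem_candidates hp.1)
    rw [if_pos] at this
    · simp at this
    · refine ⟨(L.isTrailList_support p).2 hp, ?_⟩
      rw [← huv, decide_eq_decide]
      exact head?_support p
  | some l =>
    left
    have hmem := List.mem_of_head? hf
    obtain ⟨l', hl', hif⟩ := List.mem_filterMap.1 hmem
    split_ifs at hif with hcond
    obtain rfl : l' = l := by simpa using hif
    obtain ⟨u, v, p, rfl⟩ := L.exists_walk hl' hcond.1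
    refine ⟨u, v, p, ?_, (L.isTrailList_support p).1 hcond.1, rfl⟩
    rw [← hcond.2, decide_eq_decide]
    exact (head?_support p).symm

theorem exists_computable_circuit :
    ∃ f : Code → Option (List ℕ), Computable f ∧
      ∀ (n : ℕ) (G : SimpleGraph (Fin n)) (H : G.Subgraph), H.Connected →
        ∀ L : Listing H,
          (IsSEulerian H → ∃ (u : Fin n) (p : G.Walk u u),
            IsSEulerianCircuit H p ∧ f L.code = some (p.support.map Fin.val)) ∧
          (¬ IsSEulerian H → f L.code = none) := by
  refine ⟨findTrail true, computable_findTrail true, fun n G H _ L => ?_⟩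
  rcases L.findTrail_spec true with ⟨u, v, p, huv, hp, hf⟩ | ⟨hno, hf⟩
  · obtain rfl : u = v := of_decide_eq_true huv
    exact ⟨fun _ => ⟨u, p, hp, hf⟩, fun h => absurd ⟨u, p, hp⟩ h⟩
  · exact ⟨fun ⟨u, p, hp⟩ => absurd hp (hno u u p (decide_eq_true rfl)), fun _ => hf⟩

theorem exists_computable_trail :
    ∃ f : Code → Option (List ℕ), Computable f ∧
      ∀ (n : ℕ) (G : SimpleGraph (Fin n)) (H : G.Subgraph), H.Connected →
        ∀ L : Listing H,
          (IsSemiSEulerian H → ∃ (u v : Fin n) (p : G.Walk u v),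
            IsSEulerianTrail H p ∧ f L.code = some (p.support.map Fin.val)) ∧
          (¬ IsSemiSEulerian H → f L.code = none) := by
  refine ⟨findTrail false, computable_findTrail false, fun n G H _ L => ?_⟩
  rcases L.findTrail_spec false with ⟨u, v, p, huv, hp, hf⟩ | ⟨hno, hf⟩
  · have huv : u ≠ v := of_decide_eq_false huv
    exact ⟨fun _ => ⟨u, v, p, ⟨huv, hp⟩, hf⟩, fun h => absurd ⟨u, v, p, huv, hp⟩ h⟩
  · exact ⟨fun ⟨u, v, p, huv, hp⟩ => absurd hp (hno u v p (decide_eq_false huv)), fun _ => hf⟩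

end Search

end SEulerian

theorem theorem2 :
    -- both decision problems are solvable in linear time
    SEulerian.DecidableInLinearTime (fun H => SEulerian.IsSEulerian H) ∧
    SEulerian.DecidableInLinearTime (fun H => SEulerian.IsSemiSEulerian H) ∧
    -- the characterizations behind the algorithms
    (∀ (V : Type*) [Finite V] (G : SimpleGraph V) (H : G.Subgraph), H.Connected →
      (SEulerian.IsSEulerian H ↔
        ∀ C : (SEulerian.oddGraph H).ConnectedComponent, Even C.supp.ncard) ∧
      (SEulerian.IsSEulerian H ↔
        ∃ M : (SEulerian.oddGraph H).Subgraph, M.IsPerfectMatching) ∧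
      ((SEulerian.oddVerts H).Nonempty →
        (SEulerian.IsSemiSEulerian H ↔
          ∃ M : (SEulerian.oddGraph H).Subgraph, M.IsMatching ∧ M.vertsᶜ.ncard = 2)) ∧
      (SEulerian.oddVerts H = ∅ →
        (SEulerian.IsSemiSEulerian H ↔
          ∃ e ∈ G.edgeSet, e ∉ H.edgeSet ∧ (H.edgeSet = ∅ ∨ ∃ v ∈ H.verts, v ∈ e)))) ∧
    -- algorithms that find an S-Eulerian circuit
    (∃ f : SEulerian.Code → Option (List ℕ), Computable f ∧
      ∀ (n : ℕ) (G : SimpleGraph (Fin n)) (H : G.Subgraph), H.Connected →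
        ∀ L : SEulerian.Listing H,
          (SEulerian.IsSEulerian H → ∃ (u : Fin n) (p : G.Walk u u),
            SEulerian.IsSEulerianCircuit H p ∧ f L.code = some (p.support.map Fin.val)) ∧
          (¬ SEulerian.IsSEulerian H → f L.code = none)) ∧
    -- and an S-Eulerian trail, if there is one
    (∃ f : SEulerian.Code → Option (List ℕ), Computable f ∧
      ∀ (n : ℕ) (G : SimpleGraph (Fin n)) (H : G.Subgraph), H.Connected →
        ∀ L : SEulerian.Listing H,
          (SEulerian.IsSemiSEulerian H → ∃ (u v : Fin n) (p : G.Walk u v),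
            SEulerian.IsSEulerianTrail H p ∧ f L.code = some (p.support.map Fin.val)) ∧
          (¬ SEulerian.IsSemiSEulerian H → f L.code = none)) := by
  refine ⟨SEulerian.isSEulerian_decidable, SEulerian.isSemiSEulerian_decidable, ?_,
    SEulerian.exists_computable_circuit, SEulerian.exists_computable_trail⟩
  intro V _ G H hH
  have := Fintype.ofFinite V
  exact ⟨(SEulerian.isSEulerian_iff_balanced hH).trans (SEulerian.balanced_iff_components H),
    SEulerian.isSEulerian_iff_perfectMatching hH, SEulerian.isSemiSEulerian_iff_matching hH,
    SEulerian.isSemiSEulerian_iff_exists_edge hH⟩
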